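/- Let $D_n$ be the closed unit disk with $n$ interior punctures. A train track $\tau$ on $D_n$ is a finite union of smooth arcs (branches $e_1,\dots,e_k$, with disjoint interiors, arbitrarily oriented) in the interior of $D_n$, with a common tangent line and branches on both sides at each switch, such that every component of $D_n\setminus\tau$ is an unpunctured $q$-gon with $q\ge 3$ or a once punctured $p$-gon with $p\ge 1$ (the boundary counting as a puncture). Let $N$ be a fibred neighbourhood of $\tau$, with retraction $r:N\to\tau$. The track $\tau$ is invariant under the isotopy class $\beta=[f]$ of a homeomorphism $f$ of $D_n$ (rel boundary) if, for some $\psi$ isotopic to the identity, $\psi(f(\tau))\subseteq N$ transversally to the fibres with switches on singular fibres; then $r\psi f$ maps branches to smooth edge paths, and the transition matrix $T$ has as entry $T_{ij}$ the number of occurrences of $e_i^{\pm1}$ in $r\psi f(e_j)$. Let $\pi:M\to D_n$ be the orientation double cover determined by $\tau$: the double cover of the disk, branched over at most one point in each interior complementary polygon of $\tau$ (at the puncture, if there is one) and outside $N$, for which the tangent lines of $\tilde\tau=\pi^{-1}(\tau)$ have a continuous orientation reversed by the deck involution. Let $\tilde f:M\to M$ be a homeomorphism lifting $\psi f$, let $\tilde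 r:\pi^{-1}(N)\to\tilde\tau$ be the lift of $r$, and let $\tilde T$ be the $2k\times 2k$ transition matrix of $\tilde\tau$, which counts the occurrences of the lifted branches (in either direction) in their images under $\tilde r\tilde f$. Then, for every class $\beta$ on $D_n$ (in particular every pseudo-Anosov one) and every invariant train track $\tau$ of $\beta$: (1) $T$ and $\tilde T$ are isospectral up to roots of unity and zeros: they have the same complex eigenvalues, with algebraic multiplicity, once zeros and roots of unity are discarded. (2) Call a branch infinitesimal if it bounds a complementary polygon disjoint from $\partial D_n$, and main otherwise. If $\tau$ is regular, in the sense that $r\psi f$ permutes the infinitesimal branches (each is mapped onto a single one) and maps the set of switches injectively to itself, then $T$ and $\tilde T$ are isospectral up to roots of unity: they have the same eigenvalues, with multiplicity, once roots of unity are discarded. The same holds for the submatrix of $T$ indexed by the main branches and the submatrix of $\tilde T$ indexed by the lifts of the main branches. -/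

import Mathlib

open Set Metric Topology

noncomputable section

namespace Track

/-! ### The punctured disk and its homeomorphisms -/

/-- The `n`-punctured disk: the closed unit disk of `ℂ` with `n` distinct interior punctures. -/
structure PuncturedDisk (n : ℕ) where
  punctures : Finset ℂ
  card_punctures : punctures.card = n
  norm_lt : ∀ p ∈ punctures, ‖p‖ < 1

/-- The closed unit disk, as a topological space. -/
abbrev Disk : Type := closedBall (0 : ℂ) 1

/-- A homeomorphism of the punctured disk which is the identity on the boundary circle.  It is
represented by its extension to `ℂ` by the identity. -/
def IsDiskHomeo {n : ℕ} (D : PuncturedDisk n) (f : ℂ ≃ₜ ℂ) : Prop :=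
  (∀ x, 1 ≤ ‖x‖ → f x = x) ∧ f '' (D.punctures : Set ℂ) = D.punctures

/-- `ψ` is isotopic to the identity through homeomorphisms of the punctured disk. -/
def IsotopicToId {n : ℕ} (D : PuncturedDisk n) (ψ : ℂ ≃ₜ ℂ) : Prop :=
  ∃ H : C(unitInterval × ℂ, ℂ), (∀ x, H (0, x) = x) ∧ (∀ x, H (1, x) = ψ x) ∧
    ∀ t, ∃ h : ℂ ≃ₜ ℂ, IsDiskHomeo D h ∧ ∀ x, h x = H (t, x)

/-! ### Edge paths -/

/-- On `[a, b] ⊆ [0, 1]` the path `γ` runs exactly once along the whole arc `c : [0, 1] → X`, in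
the direction of `c` (`forward = true`) or against it (`forward = false`). -/
def Traverses {X : Type*} (γ c : ℝ → X) (forward : Bool) (a b : ℝ) : Prop :=
  0 ≤ a ∧ a < b ∧ b ≤ 1 ∧ ∃ θ : ℝ → ℝ, ContinuousOn θ (Icc a b) ∧
    (∀ t ∈ Icc a b, γ t = c (θ t)) ∧
    match forward with
    | true => StrictMonoOn θ (Icc a b) ∧ θ a = 0 ∧ θ b = 1
    | false => StrictAntiOn θ (Icc a b) ∧ θ a = 1 ∧ θ b = 0

/-- On `[a, b]` the path `γ` is (up to reparametrization) the edge path given by a word in the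
oriented arcs `(i, true) = e i` and `(i, false) =` the reverse of `e i`. -/
def TracesWord {ι X : Type*} (e : ι → ℝ → X) (γ : ℝ → X) : ℝ → List (ι × Bool) → ℝ → Prop
  | a, [], b => a = b
  | a, x :: w, b => ∃ c, Traverses γ (e x.1) x.2 a c ∧ TracesWord e γ c w b

/-- The number of occurrences of `c` or its reverse in the edge path `γ : [0, 1] → X`. -/
def occurrences {X : Type*} (γ c : ℝ → X) : ℕ :=
  {p : ℝ × ℝ | ∃ s, Traverses γ c s p.1 p.2}.ncard

/-- The matrix whose `(i, j)` entry is the number of occurrences of `e i` (in either direction) in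
the edge path `F ∘ e j`. -/
def transitionMatrix {ι X : Type*} (e : ι → ℝ → X) (F : X → X) : Matrix ι ι ℕ :=
  Matrix.of fun i j => occurrences (fun t => F (e j t)) (e i)

/-! ### Systems of smooth oriented arcs in the plane -/

section Arcs

variable {ι : Type*} (e : ι → ℝ → ℂ)

/-- The union of the arcs. -/
def support : Set ℂ := ⋃ i, e i '' Icc 0 1

/-- The end points of the arcs. -/
def switches : Set ℂ := range (fun i => e i 0) ∪ range (fun i => e i 1)

/-- Initial point of an oriented arc. -/
def startPt : ι × Bool → ℂ
  | (i, true) => e i 0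
  | (i, false) => e i 1

/-- Terminal point of an oriented arc. -/
def endPt : ι × Bool → ℂ
  | (i, true) => e i 1
  | (i, false) => e i 0

/-- Velocity of an oriented arc at its initial point. -/
def startDir : ι × Bool → ℂ
  | (i, true) => deriv (e i) 0
  | (i, false) => -deriv (e i) 1

/-- Velocity of an oriented arc at its terminal point. -/
def endDir : ι × Bool → ℂ
  | (i, true) => deriv (e i) 1
  | (i, false) => -deriv (e i) 0

/-- The oriented arc `b` continues the oriented arc `a` smoothly. -/
def SmoothTurn (a b : ι × Bool) : Prop :=
  endPt e a = startPt e b ∧ SameRay ℝ (endDir e a) (startDir e b)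

open Classical in
/-- The number of cusps (non-smooth turns) of a closed edge path. -/
def cuspCount (w : List (ι × Bool)) : ℕ :=
  (w.zip (w.rotate 1)).countP fun p => ¬ SmoothTurn e p.1 p.2

/-- The component containing `x` of the complement of the arcs in the closed disk. -/
def face (x : ℂ) : Set ℂ := connectedComponentIn (closedBall 0 1 \ support e) x

/-- `C` is an open disk bounded by a closed edge path with `k` cusps. -/
def IsPolygon (C : Set ℂ) (k : ℕ) : Prop :=
  ∃ Φ : ℂ → ℂ, ContinuousOn Φ (closedBall 0 1) ∧ InjOn Φ (ball 0 1) ∧ Φ '' ball 0 1 = C ∧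
    ∃ w : List (ι × Bool), cuspCount e w = k ∧
      TracesWord e (fun t => Φ (Complex.exp (2 * Real.pi * t * Complex.I))) 0 w 1

/-- `C` is a half-open annulus, bounded on one side by the unit circle, which belongs to `C`, and
on the other side by a closed edge path with `k` cusps. -/
def IsExteriorPolygon (C : Set ℂ) (k : ℕ) : Prop :=
  ∃ Φ : ℂ → ℂ, ContinuousOn Φ {z | 1 ≤ ‖z‖ ∧ ‖z‖ ≤ 2} ∧ InjOn Φ {z | 1 < ‖z‖ ∧ ‖z‖ ≤ 2} ∧
    Φ '' {z | 1 < ‖z‖ ∧ ‖z‖ ≤ 2} = C ∧ Φ '' sphere 0 2 = sphere 0 1 ∧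
    ∃ w : List (ι × Bool), cuspCount e w = k ∧
      TracesWord e (fun t => Φ (Complex.exp (2 * Real.pi * t * Complex.I))) 0 w 1

/-- `v` is a tangent vector at `x` to the union of the arcs. -/
def IsTangentAt (x v : ℂ) : Prop :=
  ∃ i, ∃ t ∈ Icc (0 : ℝ) 1, e i t = x ∧ ∃ c : ℝ, v = c • deriv (e i) t

end Arcs

/-! ### Train tracks -/

/-- A train track on the punctured disk, with branches indexed by `ι`: finitely many smooth arcs
with disjoint interiors, with a common tangent line and arcs on both sides at each switch, whose
complementary components are unpunctured `k`-gons with `k ≥ 3` or once punctured `p`-gons with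
`p ≥ 1`, the boundary circle being regarded as a puncture.  Each branch carries an arbitrary
orientation, given by its parametrization by `[0, 1]`. -/
structure TrainTrack {n : ℕ} (D : PuncturedDisk n) (ι : Type*) [Fintype ι] where
  branch : ι → ℝ → ℂ
  contDiff : ∀ i, ContDiff ℝ 1 (branch i)
  deriv_ne_zero : ∀ i, ∀ t ∈ Icc (0 : ℝ) 1, deriv (branch i) t ≠ 0
  subset_interior : ∀ i, ∀ t ∈ Icc (0 : ℝ) 1, ‖branch i t‖ < 1 ∧ branch i t ∉ D.punctures
  embedded : ∀ i j, ∀ s ∈ Ioo (0 : ℝ) 1, ∀ t ∈ Icc (0 : ℝ) 1,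
    branch i s = branch j t → i = j ∧ s = t
  tangent_line : ∀ a b, endPt branch a = endPt branch b →
    SameRay ℝ (endDir branch a) (endDir branch b) ∨ SameRay ℝ (endDir branch a) (-endDir branch b)
  two_sided : ∀ a, ∃ b, SmoothTurn branch a b
  interior_face : ∀ x ∈ closedBall (0 : ℂ) 1 \ support branch,
    Disjoint (face branch x) (sphere 0 1) →
      ∃ k, IsPolygon branch (face branch x) k ∧
        ((Disjoint (face branch x) D.punctures ∧ 3 ≤ k) ∨
          ((face branch x ∩ D.punctures).ncard = 1 ∧ 1 ≤ k))
  exterior_face : ∀ x ∈ closedBall (0 : ℂ) 1 \ support branch,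
    ¬ Disjoint (face branch x) (sphere 0 1) →
      ∃ k, IsExteriorPolygon branch (face branch x) k ∧
        Disjoint (face branch x) D.punctures ∧ 1 ≤ k

section Carrying

variable {n : ℕ} {D : PuncturedDisk n} {ι : Type*} [Fintype ι]

/-- A fibred neighbourhood of `τ`: a regular neighbourhood `carrier` with a retraction `retr` onto
`τ`, which is a deformation retraction along its fibres.  The fibre over a point which is not a
switch is an arc; the fibre over a switch is a singular leaf. -/
structure FibredNhd (τ : TrainTrack D ι) where
  carrier : Set ℂ
  isCompact : IsCompact carrier
  mem_nhdsSet : carrier ∈ 𝓝ˢ (support τ.branch)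
  subset_interior : carrier ⊆ ball 0 1 \ D.punctures
  retr : ℂ → ℂ
  retr_continuousOn : ContinuousOn retr carrier
  retr_mapsTo : MapsTo retr carrier (support τ.branch)
  retr_eq : ∀ x ∈ support τ.branch, retr x = x
  fibre_arc : ∀ x ∈ support τ.branch \ switches τ.branch,
    Nonempty (unitInterval ≃ₜ {y : ℂ // y ∈ carrier ∧ retr y = x})
  deformation : ∃ H : ℝ × ℂ → ℂ, ContinuousOn H (Icc 0 1 ×ˢ carrier) ∧
    (∀ x ∈ carrier, H (0, x) = x ∧ H (1, x) = retr x) ∧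
    (∀ t ∈ Icc (0 : ℝ) 1, ∀ x ∈ carrier, H (t, x) ∈ carrier ∧ retr (H (t, x)) = retr x) ∧
    ∀ t ∈ Icc (0 : ℝ) 1, ∀ x ∈ support τ.branch, H (t, x) = x
  compl_connected : ∀ x ∈ closedBall (0 : ℂ) 1 \ support τ.branch,
    IsConnected (face τ.branch x \ carrier)

/-- The word of the image of an oriented branch, given the words of the images of the branches. -/
def orientedImage (W : ι → List (ι × Bool)) : ι × Bool → List (ι × Bool)
  | (i, true) => W i
  | (i, false) => ((W i).map fun x => (x.1, !x.2)).reverse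

/-- The image `g(τ)` lies in the fibred neighbourhood `N` of `τ`, transversally to the fibres and
with its switches on singular leaves: `retr ∘ g` turns each branch, and each smooth passage from a
branch to another one through a switch, into a smooth edge path of `τ`. -/
def CarriesImage (τ : TrainTrack D ι) (N : FibredNhd τ) (g : ℂ → ℂ) : Prop :=
  MapsTo g (support τ.branch) N.carrier ∧
  ∃ W : ι → List (ι × Bool),
    (∀ j, TracesWord τ.branch (fun t => N.retr (g (τ.branch j t))) 0 (W j) 1) ∧
    (∀ j, (W j).IsChain (SmoothTurn τ.branch)) ∧
    ∀ a b, SmoothTurn τ.branch a b →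
      ∀ x ∈ (orientedImage W a).getLast?, ∀ y ∈ (orientedImage W b).head?,
        SmoothTurn τ.branch x y

/-- A branch is infinitesimal if it bounds an interior polygon (a complementary component disjoint
from the boundary circle); otherwise it is a main branch. -/
def IsInfinitesimal (τ : TrainTrack D ι) (i : ι) : Prop :=
  ∃ x ∈ closedBall (0 : ℂ) 1 \ support τ.branch, Disjoint (face τ.branch x) (sphere 0 1) ∧
    (τ.branch i '' Ioo 0 1 ∩ closure (face τ.branch x)).Nonempty

/-- `τ` is regular for `g`: the infinitesimal branches are permuted, and the switches are sent
injectively to switches. -/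
def IsRegularFor (τ : TrainTrack D ι) (N : FibredNhd τ) (g : ℂ → ℂ) : Prop :=
  (∃ σ : Equiv.Perm {i // IsInfinitesimal τ i}, ∀ j : {i // IsInfinitesimal τ i}, ∃ s,
    Traverses (fun t => N.retr (g (τ.branch (j : ι) t))) (τ.branch (σ j : ι)) s 0 1) ∧
  InjOn (fun x => N.retr (g x)) (switches τ.branch)

/-! ### The orientation double cover -/

/-- `M`, with the projection `proj`, is an orientation double cover of the disk for the train
track `τ`: a double cover branched exactly over the points of `branchPts`, with at most one branch
point in each interior polygon (the puncture, if there is one) and none elsewhere, on which the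
tangent lines of `τ` acquire a continuous orientation `dir` which is reversed by the deck
involution `deck`. -/
structure OrientationDoubleCover (τ : TrainTrack D ι) (M : Type*) [TopologicalSpace M] where
  t2 : T2Space M
  proj : M → Disk
  proj_continuous : Continuous proj
  proj_surjective : Function.Surjective proj
  deck : M ≃ₜ M
  proj_eq_iff : ∀ y z, proj y = proj z ↔ z = y ∨ z = deck y
  branchPts : Set ℂ
  deck_eq_iff : ∀ y, deck y = y ↔ (proj y : ℂ) ∈ branchPts
  branchPts_finite : branchPts.Finite
  branchPts_subset : branchPts ⊆ ball 0 1 \ support τ.branch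
  branchPts_face : ∀ b ∈ branchPts, Disjoint (face τ.branch b) (sphere 0 1) ∧
    face τ.branch b ∩ branchPts = {b} ∧ face τ.branch b ∩ D.punctures ⊆ {b}
  isCoveringMapOn : IsCoveringMapOn proj {x | (x : ℂ) ∉ branchPts}
  branch_chart : ∀ y, (proj y : ℂ) ∈ branchPts →
    ∃ (φ : OpenPartialHomeomorph M ℂ) (χ : OpenPartialHomeomorph Disk ℂ),
      y ∈ φ.source ∧ φ y = 0 ∧ ∀ z ∈ φ.source, proj z ∈ χ.source ∧ χ (proj z) = φ z ^ 2
  dir : M → ℂ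
  dir_continuousOn : ContinuousOn dir {y | (proj y : ℂ) ∈ support τ.branch}
  dir_tangent : ∀ y, (proj y : ℂ) ∈ support τ.branch →
    ‖dir y‖ = 1 ∧ IsTangentAt τ.branch (proj y) (dir y)
  dir_deck : ∀ y, (proj y : ℂ) ∈ support τ.branch → dir (deck y) = -dir y

variable {τ : TrainTrack D ι} {M : Type*} [TopologicalSpace M]

/-- `lift (i, false)` and `lift (i, true)` are the two lifts of the branch `i` to `M`; together
they are the branches of the lifted train track, the preimage of `τ`. -/
def AreBranchLifts (c : OrientationDoubleCover τ M) (lift : ι × Bool → ℝ → M) : Prop :=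
  (∀ x, ContinuousOn (lift x) (Icc 0 1) ∧
    ∀ t ∈ Icc (0 : ℝ) 1, (c.proj (lift x t) : ℂ) = τ.branch x.1 t) ∧
  ∀ i, lift (i, false) 0 ≠ lift (i, true) 0

/-- `lr` is the retraction, lifting `N.retr`, of the preimage of `N` onto the lifted train
track. -/
def IsLiftedRetraction (c : OrientationDoubleCover τ M) (N : FibredNhd τ) (lr : M → M) : Prop :=
  ContinuousOn lr {y | (c.proj y : ℂ) ∈ N.carrier} ∧
  (∀ y, (c.proj y : ℂ) ∈ N.carrier → (c.proj (lr y) : ℂ) = N.retr (c.proj y)) ∧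
  ∀ y, (c.proj y : ℂ) ∈ support τ.branch → lr y = y

end Carrying

/-! ### Isospectrality -/

/-- The complex eigenvalues, with algebraic multiplicity. -/
def eigenvalues {κ : Type*} [Fintype κ] [DecidableEq κ] (T : Matrix κ κ ℕ) : Multiset ℂ :=
  (T.map (Nat.cast : ℕ → ℂ)).charpoly.roots

/-- `z` is a root of unity. -/
def IsUnityRoot (z : ℂ) : Prop := ∃ m : ℕ, 0 < m ∧ z ^ m = 1

open Classical in
/-- The same eigenvalues, with multiplicity, once roots of unity are discarded. -/
def IsospectralUpToUnity {κ κ' : Type*} [Fintype κ] [Fintype κ'] [DecidableEq κ] [DecidableEq κ']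
    (S : Matrix κ κ ℕ) (T : Matrix κ' κ' ℕ) : Prop :=
  (eigenvalues S).filter (fun z => ¬ IsUnityRoot z) =
    (eigenvalues T).filter (fun z => ¬ IsUnityRoot z)

open Classical in
/-- The same eigenvalues, with multiplicity, once roots of unity and zeros are discarded. -/
def IsospectralUpToUnityAndZero {κ κ' : Type*} [Fintype κ] [Fintype κ'] [DecidableEq κ]
    [DecidableEq κ'] (S : Matrix κ κ ℕ) (T : Matrix κ' κ' ℕ) : Prop :=
  (eigenvalues S).filter (fun z => z ≠ 0 ∧ ¬ IsUnityRoot z) =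
    (eigenvalues T).filter (fun z => z ≠ 0 ∧ ¬ IsUnityRoot z)

end Track

end

/-!
The transition matrix of the lifted track splits into the transition matrix `T` of the track and
the matrix `± S`, where `S` counts the occurrences of the branches with sign: the orientation `dir`
of the lifted track distinguishes, over each branch, the lift parametrized along `dir` from the
other one (`isPositive`), a letter of the image of a branch lifts to the one or to the other
according to its sign (`AreBranchLifts.occurrences_eq`), and the lifted map preserves or reverses
`dir` globally, because a train track is connected and the lifted map commutes with the deck
involution (`exists_global_preserves`).  Exchanging the two lifts, the lifted matrix is
`[[A, B], [B, A]]` with `A + B = T` and `A - B = ± S`, so its characteristic polynomial is the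
product of those of `T` and `± S`.

It remains to see that the eigenvalues of `S` are zeros and roots of unity.  The matrix `S` is the
action on the cellular chains of the track.  On an eigenvector with nonzero boundary, the
eigenvalue is one of a self-map of the finite set of switches (`eigenvalue_of_not_isCycle`).  On a
cycle `v`, the winding number of `S v` about a point `p` off the neighbourhood is that of `v` about
the preimage of `p`, and winding numbers of `v` take finitely many values (`eigenvalue_of_isCycle`);
they do not all vanish, since the winding number jumps by `v i` across the branch `i`
(`exists_winding_sub_winding`).  Winding numbers are defined through continuous logarithms, and all
comparisons of them come from one lemma on homotopies of nonvanishing functions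
(`exists_log_of_homotopy`).

For a regular track `S` is injective (`IsRegularFor.isUnityRoot`), as cycles are supported on the
infinitesimal branches, which are permuted; and the eigenvalues of the block of `S` of the main
branches are eigenvalues of `S`, as images of infinitesimal branches are infinitesimal.
-/

namespace Track

/-! ### Continuous logarithms -/

theorem _root_.IsPreconnected.eq_of_eventually_eq {α β : Type*} [TopologicalSpace α] {s : Set α}
    (hs : IsPreconnected s) {f : α → β} (hf : ∀ x ∈ s, ∀ᶠ y in 𝓝[s] x, f y = f x) {x y : α}
    (hx : x ∈ s) (hy : y ∈ s) : f x = f y :=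
  hs.induction₂ (fun x y => f x = f y) (fun x hx => (hf x hx).mono fun _ h => h.symm)
    (fun _ _ _ _ _ _ => Eq.trans) (fun _ _ _ _ => Eq.symm) hx hy

theorem _root_.IsPreconnected.pos_iff_pos {α : Type*} [TopologicalSpace α] {s : Set α}
    (hs : IsPreconnected s) {f : α → ℝ} (hf : ContinuousOn f s) (h0 : ∀ x ∈ s, f x ≠ 0) {x y : α}
    (hx : x ∈ s) (hy : y ∈ s) : 0 < f x ↔ 0 < f y := by
  refine iff_of_eq (hs.eq_of_eventually_eq (f := fun x => 0 < f x) (fun x hx => ?_) hx hy)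
  rcases lt_or_gt_of_ne (h0 x hx) with h | h
  · filter_upwards [(hf x hx).eventually_lt_const h] with y hy
    simp [h.not_gt, hy.not_gt]
  · filter_upwards [(hf x hx).eventually_const_lt h] with y hy
    simp [h, hy]

/-- A family of nonvanishing functions on a compact set that starts at the constant `1` ends at a
function with a continuous logarithm: subdivide the time interval so finely that consecutive ratios
stay near `1`, and add up their principal logarithms. -/
theorem exists_log_of_homotopy {X : Type*} [PseudoMetricSpace X] {S : Set X} (hS : IsCompact S)
    {K : ℝ × X → ℂ} (hK : ContinuousOn K (Icc 0 1 ×ˢ S)) (h0 : ∀ p ∈ Icc (0 : ℝ) 1 ×ˢ S, K p ≠ 0)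
    (h1 : ∀ x ∈ S, K (0, x) = 1) :
    ∃ l : X → ℂ, ContinuousOn l S ∧ ∀ x ∈ S, Complex.exp (l x) = K (1, x) := by
  have hC : IsCompact (Icc (0 : ℝ) 1 ×ˢ S) := isCompact_Icc.prod hS
  obtain ⟨m, hm, hm'⟩ := hC.exists_forall_le' hK.norm (a := 0) fun p hp => norm_pos_iff.2 (h0 p hp)
  obtain ⟨δ, hδ, hu⟩ :=
    Metric.uniformContinuousOn_iff.1 (hC.uniformContinuousOn_of_continuous hK) m hm
  obtain ⟨n, hn⟩ := exists_nat_one_div_lt hδ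
  set N : ℝ := n + 1 with hN
  have hNpos : 0 < N := by positivity
  have hmem : ∀ k : ℕ, k ≤ n + 1 → (k : ℝ) / N ∈ Icc (0 : ℝ) 1 := fun k hk => by
    refine ⟨by positivity, (div_le_one hNpos).2 ?_⟩
    rw [hN]; exact_mod_cast hk
  have hslit : ∀ k < n + 1, ∀ x ∈ S,
      K (((k + 1 : ℕ) : ℝ) / N, x) / K ((k : ℝ) / N, x) ∈ Complex.slitPlane := by
    intro k hk x hx
    have hk0 := h0 ((k : ℝ) / N, x) ⟨hmem k hk.le, hx⟩
    have hd := hu (((k + 1 : ℕ) : ℝ) / N, x) ⟨hmem _ hk, hx⟩ ((k : ℝ) / N, x) ⟨hmem k hk.le, hx⟩ (by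
      rw [Prod.dist_eq, dist_self, Real.dist_eq, max_eq_left (abs_nonneg _), ← sub_div]
      push_cast
      rw [add_sub_cancel_left, abs_of_pos (by positivity)]
      exact hn)
    rw [dist_eq_norm] at hd
    have := Complex.mem_slitPlane_of_norm_lt_one
      (z := (K (((k + 1 : ℕ) : ℝ) / N, x) - K ((k : ℝ) / N, x)) / K ((k : ℝ) / N, x)) (by
        rw [norm_div, div_lt_one (norm_pos_iff.2 hk0)]
        exact hd.trans_le (hm' _ ⟨hmem k hk.le, hx⟩))
    rwa [sub_div, div_self hk0, add_sub_cancel] at this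
  refine ⟨fun x => ∑ k ∈ Finset.range (n + 1),
    Complex.log (K (((k + 1 : ℕ) : ℝ) / N, x) / K ((k : ℝ) / N, x)), ?_, fun x hx => ?_⟩
  · refine continuousOn_finsetSum _ fun k hk => ?_
    rw [Finset.mem_range] at hk
    have hc : ∀ k ≤ n + 1, ContinuousOn (fun x => K ((k : ℝ) / N, x)) S := fun k hk =>
      hK.comp (by fun_prop) fun x hx => ⟨hmem k hk, hx⟩
    exact ((hc _ hk).div (hc _ hk.le) fun x hx => h0 _ ⟨hmem k hk.le, hx⟩).clog (hslit k hk)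
  · have key : ∀ j ≤ n + 1, Complex.exp (∑ k ∈ Finset.range j,
        Complex.log (K (((k + 1 : ℕ) : ℝ) / N, x) / K ((k : ℝ) / N, x))) = K ((j : ℝ) / N, x) := by
      intro j
      induction j with
      | zero => intro _; simp [h1 x hx]
      | succ j ih =>
        intro hj
        have hj0 := h0 ((j : ℝ) / N, x) ⟨hmem j (by omega), hx⟩
        rw [Finset.sum_range_succ, Complex.exp_add, ih (by omega),
          Complex.exp_log (Complex.slitPlane_ne_zero (hslit j hj x hx)), mul_div_cancel₀ _ hj0]
    have := key (n + 1) le_rfl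
    rwa [show (((n + 1 : ℕ) : ℝ) / N) = 1 by rw [hN]; push_cast; exact div_self hNpos.ne'] at this

theorem sub_eq_sub_of_exp_eq {A B : ℝ → ℂ} {a b : ℝ} (hab : a ≤ b) (hA : ContinuousOn A (Icc a b))
    (hB : ContinuousOn B (Icc a b)) {C : ℂ}
    (h : ∀ t ∈ Icc a b, Complex.exp (A t) = C * Complex.exp (B t)) : A b - A a = B b - B a := by
  have key : A b - B b = A a - B a := by
    refine isPreconnected_Icc.eq_of_eventually_eq (f := fun t => A t - B t) (fun s hs => ?_)
      (right_mem_Icc.2 hab) (left_mem_Icc.2 hab)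
    filter_upwards [Metric.tendsto_nhds.1 ((hA.sub hB) s hs) (2 * Real.pi) Real.two_pi_pos,
      self_mem_nhdsWithin] with t ht hts
    have he : ∀ t ∈ Icc a b, Complex.exp (A t - B t) = C := fun t ht => by
      rw [Complex.exp_sub, h t ht, mul_div_cancel_right₀ _ (Complex.exp_ne_zero _)]
    obtain ⟨k, hk⟩ := Complex.exp_eq_exp_iff_exists_int.1 ((he t hts).trans (he s hs).symm)
    rw [dist_eq_norm, Pi.sub_apply, Pi.sub_apply, hk, add_sub_cancel_left] at ht
    -- the two values differ by a multiple of `2πi` of norm less than `2π`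
    have hk0 : |(k : ℝ)| < 1 := by
      have : ‖(k : ℂ) * (2 * Real.pi * Complex.I)‖ = |(k : ℝ)| * (2 * Real.pi) := by
        simp [abs_of_pos Real.pi_pos]
      rw [this] at ht
      nlinarith [Real.two_pi_pos]
    have : k = 0 := by
      rw [← Int.abs_lt_one_iff]; exact_mod_cast hk0
    rw [hk, this]; simp
  linear_combination key

open Classical in
/-- The increment of a continuous logarithm of `γ` along `[0, 1]`. -/
noncomputable def logInc (γ : ℝ → ℂ) : ℂ :=
  if h : ∃ L : ℝ → ℂ, ContinuousOn L (Icc 0 1) ∧ ∀ t ∈ Icc (0 : ℝ) 1, Complex.exp (L t) = γ t then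
    h.choose 1 - h.choose 0 else 0

theorem exists_log_path {γ : ℝ → ℂ} (hγ : ContinuousOn γ (Icc 0 1))
    (h0 : ∀ t ∈ Icc (0 : ℝ) 1, γ t ≠ 0) :
    ∃ L : ℝ → ℂ, ContinuousOn L (Icc 0 1) ∧ ∀ t ∈ Icc (0 : ℝ) 1, Complex.exp (L t) = γ t := by
  have hm : ∀ p ∈ Icc (0 : ℝ) 1 ×ˢ Icc (0 : ℝ) 1, p.1 * p.2 ∈ Icc (0 : ℝ) 1 := fun p hp =>
    ⟨mul_nonneg hp.1.1 hp.2.1, mul_le_one₀ hp.1.2 hp.2.1 hp.2.2⟩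
  have h00 := h0 0 (by simp)
  obtain ⟨l, hl, hl'⟩ := exists_log_of_homotopy (K := fun p => γ (p.1 * p.2) / γ 0)
    (isCompact_Icc (a := (0 : ℝ)) (b := 1)) ((hγ.comp (by fun_prop) hm).div_const _)
    (fun p hp => div_ne_zero (h0 _ (hm p hp)) h00) (fun x _ => by simp [h00])
  refine ⟨fun t => l t + Complex.log (γ 0), hl.add continuousOn_const, fun t ht => ?_⟩
  rw [Complex.exp_add, hl' t ht, Complex.exp_log h00, one_mul, div_mul_cancel₀ _ h00]

theorem logInc_eq {γ L : ℝ → ℂ} {C : ℂ} (hC : C ≠ 0) (hL : ContinuousOn L (Icc 0 1))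
    (h : ∀ t ∈ Icc (0 : ℝ) 1, Complex.exp (L t) = C * γ t) : logInc γ = L 1 - L 0 := by
  have hex : ∃ L : ℝ → ℂ, ContinuousOn L (Icc 0 1) ∧
      ∀ t ∈ Icc (0 : ℝ) 1, Complex.exp (L t) = γ t :=
    ⟨fun t => L t - Complex.log C, hL.sub continuousOn_const, fun t ht => by
      rw [Complex.exp_sub, h t ht, Complex.exp_log hC, mul_div_cancel_left₀ _ hC]⟩
  rw [logInc, dif_pos hex]
  refine (sub_eq_sub_of_exp_eq zero_le_one hL hex.choose_spec.1 (C := C) fun t ht => ?_).symm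
  rw [h t ht, hex.choose_spec.2 t ht]

/-! ### Winding numbers of cycles -/

theorem mobius_im {u : ℂ} {r : ℝ} : ((u - r * Complex.I) / (u + r * Complex.I)).im =
    -(2 * r * u.re) / Complex.normSq (u + r * Complex.I) := by
  rw [Complex.div_im]; simp; ring

theorem mobius_mem_slitPlane_of_re_ne_zero {u : ℂ} {r : ℝ} (hr : 0 < r) (hu : u.re ≠ 0) :
    (u - r * Complex.I) / (u + r * Complex.I) ∈ Complex.slitPlane := by
  refine Complex.mem_slitPlane_iff.2 (Or.inr ?_)
  have h0 : u + r * Complex.I ≠ 0 := fun h => hu (by simpa using congrArg Complex.re h)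
  rw [mobius_im]
  exact div_ne_zero (by simp [hr.ne', hu]) (by simpa using h0)

theorem mobius_mem_slitPlane_of_lt_norm {u : ℂ} {r : ℝ} (hr : 0 < r) (hu : r < ‖u‖) :
    (u - r * Complex.I) / (u + r * Complex.I) ∈ Complex.slitPlane := by
  refine Complex.mem_slitPlane_iff.2 (Or.inl ?_)
  have h0 : u + r * Complex.I ≠ 0 := fun h => by
    rw [eq_neg_of_add_eq_zero_left h] at hu
    simp [abs_of_pos hr] at hu
  have h1 : r ^ 2 < u.re ^ 2 + u.im ^ 2 := by
    have : r ^ 2 < ‖u‖ ^ 2 := by gcongr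
    rw [Complex.sq_norm, Complex.normSq_apply] at this
    nlinarith
  rw [Complex.div_re, ← add_div]
  refine div_pos ?_ (Complex.normSq_pos.2 h0)
  simp
  nlinarith

section Winding

variable {ι : Type*}

/-- The increment along the arc `e j` of a continuous logarithm of the distance vector from `p`. -/
noncomputable def turning (e : ι → ℝ → ℂ) (p : ℂ) (j : ι) : ℂ := logInc fun t => e j t - p

theorem turning_eq_add {e : ι → ℝ → ℂ} {j : ι} (he : ContinuousOn (e j) (Icc 0 1)) {p q C : ℂ}
    (hq : ∀ t ∈ Icc (0 : ℝ) 1, e j t ≠ q) {L : ℝ → ℂ} (hL : ContinuousOn L (Icc 0 1)) (hC : C ≠ 0)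
    (h : ∀ t ∈ Icc (0 : ℝ) 1, Complex.exp (L t) * (e j t - q) = C * (e j t - p)) :
    turning e p j = turning e q j + (L 1 - L 0) := by
  obtain ⟨A, hA, hA'⟩ := exists_log_path (γ := fun t => e j t - q) (he.sub continuousOn_const)
    fun t ht => sub_ne_zero.2 (hq t ht)
  have h1 : turning e q j = A 1 - A 0 := logInc_eq one_ne_zero hA (by simpa using hA')
  have h2 : turning e p j = (A + L) 1 - (A + L) 0 := logInc_eq hC (hA.add hL) fun t ht => by
    rw [Pi.add_apply, Complex.exp_add, hA' t ht, ← h t ht, mul_comm]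
  rw [h1, h2, Pi.add_apply, Pi.add_apply]
  ring

variable [Fintype ι]

/-- The winding number about `p`, times `2πi`, of the complex chain `v` on the arcs `e`. -/
noncomputable def winding (e : ι → ℝ → ℂ) (v : ι → ℂ) (p : ℂ) : ℂ := ∑ j, v j * turning e p j

/-- The pairing of the chain `v` with the coboundary of a function `h` on the end points. -/
noncomputable def coboundary (e : ι → ℝ → ℂ) (v : ι → ℂ) (h : ℂ → ℂ) : ℂ :=
  ∑ j, v j * (h (e j 1) - h (e j 0))

/-- The chain `v` has zero boundary, expressed by duality. -/
def IsCycle (e : ι → ℝ → ℂ) (v : ι → ℂ) : Prop := ∀ h, coboundary e v h = 0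

variable {n : ℕ} {D : PuncturedDisk n} (τ : TrainTrack D ι)

theorem TrainTrack.continuous_branch (i : ι) : Continuous (τ.branch i) := (τ.contDiff i).continuous

theorem TrainTrack.mem_support {i : ι} {t : ℝ} (ht : t ∈ Icc (0 : ℝ) 1) :
    τ.branch i t ∈ support τ.branch := mem_iUnion.2 ⟨i, t, ht, rfl⟩

theorem TrainTrack.branch_ne {p : ℂ} (hp : p ∉ support τ.branch) {i : ι} {t : ℝ}
    (ht : t ∈ Icc (0 : ℝ) 1) : τ.branch i t ≠ p := fun h => hp (h ▸ τ.mem_support ht)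

theorem TrainTrack.isCompact_support : IsCompact (support τ.branch) :=
  isCompact_iUnion fun i => isCompact_Icc.image (τ.continuous_branch i)

theorem TrainTrack.norm_lt_one {x : ℂ} (hx : x ∈ support τ.branch) : ‖x‖ < 1 := by
  obtain ⟨i, t, ht, rfl⟩ := mem_iUnion.1 hx
  exact (τ.subset_interior i t ht).1

theorem TrainTrack.finite_switches : (switches τ.branch).Finite :=
  (finite_range _).union (finite_range _)

variable {τ} {v : ι → ℂ} (hv : IsCycle τ.branch v)
include hv

theorem winding_eq_of_log {p q C : ℂ} (hq : q ∉ support τ.branch) {l : ℂ → ℂ}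
    (hl : ContinuousOn l (support τ.branch)) (hC : C ≠ 0)
    (h : ∀ x ∈ support τ.branch, Complex.exp (l x) * (x - q) = C * (x - p)) :
    winding τ.branch v p = winding τ.branch v q := by
  have h1 : ∀ j, turning τ.branch p j = turning τ.branch q j +
      (l (τ.branch j 1) - l (τ.branch j 0)) := fun j =>
    turning_eq_add (τ.continuous_branch j).continuousOn
      (fun t ht => τ.branch_ne hq ht) (L := fun t => l (τ.branch j t))
      (hl.comp (τ.continuous_branch j).continuousOn fun t ht => τ.mem_support ht) hC
      (fun t ht => h _ (τ.mem_support ht))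
  have h2 := hv l
  rw [coboundary] at h2
  simp only [winding, h1, mul_add, Finset.sum_add_distrib, h2, add_zero]

theorem winding_eq_zero_of_one_le_norm {p : ℂ} (hp : 1 ≤ ‖p‖) : winding τ.branch v p = 0 := by
  have hp0 : p ≠ 0 := norm_pos_iff.1 (by linarith)
  have hs : ∀ x ∈ support τ.branch, 1 + -x / p ∈ Complex.slitPlane := fun x hx => by
    refine Complex.mem_slitPlane_of_norm_lt_one ?_
    rw [norm_div, norm_neg, div_lt_one (by linarith)]
    exact (τ.norm_lt_one hx).trans_le hp
  have h1 : ∀ j, turning τ.branch p j = Complex.log (1 + -τ.branch j 1 / p) -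
      Complex.log (1 + -τ.branch j 0 / p) := fun j => by
    refine logInc_eq (C := -p⁻¹) (L := fun t => Complex.log (1 + -τ.branch j t / p))
      (by simpa using hp0) (ContinuousOn.clog ?_ fun t ht => hs _ (τ.mem_support ht))
      fun t ht => ?_
    · have := τ.continuous_branch j
      fun_prop
    · rw [Complex.exp_log (Complex.slitPlane_ne_zero (hs _ (τ.mem_support ht)))]
      field_simp
      ring
  have h2 := hv fun x => Complex.log (1 + -x / p)
  rw [coboundary] at h2
  simp only [winding, h1, h2]

theorem winding_eventually_eq {p : ℂ} (hp : p ∉ support τ.branch) :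
    ∀ᶠ q in 𝓝 p, winding τ.branch v q = winding τ.branch v p := by
  obtain ⟨r, hr, hr'⟩ := Metric.isOpen_iff.1 τ.isCompact_support.isClosed.isOpen_compl p hp
  filter_upwards [ball_mem_nhds p hr] with q hq
  have hne : ∀ x ∈ support τ.branch, x - p ≠ 0 := fun x hx h =>
    hp (sub_eq_zero.1 h ▸ hx)
  have hs : ∀ x ∈ support τ.branch, 1 + (p - q) / (x - p) ∈ Complex.slitPlane := fun x hx => by
    refine Complex.mem_slitPlane_of_norm_lt_one ?_
    rw [norm_div, div_lt_one (norm_pos_iff.2 (hne x hx)), ← dist_eq_norm, ← dist_eq_norm, dist_comm]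
    refine (mem_ball.1 hq).trans_le (not_lt.1 fun h => hr' (mem_ball.2 h) hx)
  refine winding_eq_of_log hv hp (C := 1) (l := fun x => Complex.log (1 + (p - q) / (x - p)))
    (ContinuousOn.clog ?_ hs) one_ne_zero fun x hx => ?_
  · exact continuousOn_const.add (continuousOn_const.div (by fun_prop) hne)
  · rw [Complex.exp_log (Complex.slitPlane_ne_zero (hs x hx))]
    have := hne x hx
    field_simp
    ring

theorem winding_eq_of_mem_face {x y : ℂ} (hx : x ∈ closedBall (0 : ℂ) 1 \ support τ.branch)
    (hy : y ∈ face τ.branch x) : winding τ.branch v y = winding τ.branch v x :=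
  isPreconnected_connectedComponentIn.eq_of_eventually_eq (fun _ hz =>
    (winding_eventually_eq hv (connectedComponentIn_subset _ _ hz).2).filter_mono inf_le_left) hy
    (mem_connectedComponentIn hx)

/-- The winding number jumps by `v i` across the midpoint of the branch `i`.  In the coordinate
`u = (x - z) / d` at the midpoint `z`, where `d` is the velocity, the quotient of the distance
vectors from the two points is `(u - r I) / (u + r I)`.  Along the track this meets the negative
real axis only at the midpoint, where its principal logarithm jumps by `2πi`. -/
theorem exists_winding_sub_winding (i : ι) :
    ∃ r₀ : ℝ, 0 < r₀ ∧ ∀ r ∈ Ioo 0 r₀,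
      τ.branch i (1 / 2) + r * Complex.I * deriv (τ.branch i) (1 / 2) ∉ support τ.branch ∧
      τ.branch i (1 / 2) - r * Complex.I * deriv (τ.branch i) (1 / 2) ∉ support τ.branch ∧
      winding τ.branch v (τ.branch i (1 / 2) + r * Complex.I * deriv (τ.branch i) (1 / 2)) -
        winding τ.branch v (τ.branch i (1 / 2) - r * Complex.I * deriv (τ.branch i) (1 / 2)) =
          2 * Real.pi * Complex.I * v i := by
  set z := τ.branch i (1 / 2) with hz
  set d := deriv (τ.branch i) (1 / 2) with hd
  have hd0 : d ≠ 0 := τ.deriv_ne_zero i _ ⟨by norm_num, by norm_num⟩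
  -- near the midpoint the sign of the real part of `u` is that of `t - 1 / 2`
  have hder : HasDerivAt (fun t => ((τ.branch i t - z) / d).re) 1 (1 / 2) := by
    have h1 : HasDerivAt (τ.branch i) d (1 / 2) :=
      ((τ.contDiff i).differentiable one_ne_zero _).hasDerivAt
    have h2 : HasDerivAt (fun t => ((τ.branch i t - z) / d).re) (Complex.reCLM (d / d)) (1 / 2) :=
      Complex.reCLM.hasFDerivAt.comp_hasDerivAt _ ((h1.sub_const z).div_const d)
    simpa [div_self hd0] using h2
  obtain ⟨δ, hδ, hnear⟩ : ∃ δ > 0, δ ≤ 1 / 4 ∧ ∀ t, t ≠ 1 / 2 → |t - 1 / 2| ≤ δ →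
      0 < (t - 1 / 2)⁻¹ * ((τ.branch i t - z) / d).re := by
    have h1 := (hasDerivAt_iff_tendsto_slope.1 hder).eventually_const_lt zero_lt_one
    rw [eventually_nhdsWithin_iff, Metric.eventually_nhds_iff] at h1
    obtain ⟨δ, hδ, h⟩ := h1
    refine ⟨min (δ / 2) (1 / 4), by positivity, min_le_right _ _, fun t ht htδ => ?_⟩
    have := h (y := t) (by rw [Real.dist_eq]; linarith [min_le_left (δ / 2) (1 / 4)]) ht
    simpa [slope, hz] using this
  obtain ⟨hδ4, hnear⟩ := hnear
  -- the rest of the track stays away from the midpoint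
  set far : Set ℂ := ⋃ j, τ.branch j '' {t | t ∈ Icc (0 : ℝ) 1 ∧ (j = i → δ ≤ |t - 1 / 2|)} with hfar
  have hcompact : IsCompact far := by
    refine isCompact_iUnion fun j => IsCompact.image ?_ (τ.continuous_branch j)
    by_cases hj : j = i
    · have : {t | t ∈ Icc (0 : ℝ) 1 ∧ (j = i → δ ≤ |t - 1 / 2|)} =
          Icc (0 : ℝ) 1 ∩ {t | δ ≤ |t - 1 / 2|} := by ext t; simp [hj]
      rw [this]
      exact isCompact_Icc.inter_right (isClosed_le continuous_const (by fun_prop))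
    · simp only [hj, false_imp_iff, and_true]
      exact isCompact_Icc
  obtain ⟨m, hm, hm'⟩ := hcompact.exists_forall_le' (f := fun x => ‖(x - z) / d‖) (a := 0)
    (by fun_prop) (fun x hx => by
      obtain ⟨j, t, ⟨ht, htδ⟩, rfl⟩ := mem_iUnion.1 hx
      refine norm_pos_iff.2 (div_ne_zero (sub_ne_zero.2 fun h => ?_) hd0)
      obtain ⟨rfl, h2⟩ := τ.embedded i j (1 / 2) ⟨by norm_num, by norm_num⟩ t ht h.symm
      have := htδ rfl
      rw [← h2] at this
      simp at this
      linarith)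
  refine ⟨m, hm, fun r hr => ?_⟩
  obtain ⟨hr0, hrm⟩ := hr
  have hsupp : ∀ j, ∀ t ∈ Icc (0 : ℝ) 1, τ.branch j t ∈ far ∨ (j = i ∧ |t - 1 / 2| ≤ δ) :=
    fun j t ht => by
      by_cases h : j = i ∧ |t - 1 / 2| ≤ δ
      · exact Or.inr h
      · refine Or.inl (mem_iUnion.2 ⟨j, t, ⟨ht, fun hj => ?_⟩, rfl⟩)
        by_contra h'
        exact h ⟨hj, (not_le.1 h').le⟩
  set R : ℂ → ℂ := fun x => ((x - z) / d - r * Complex.I) / ((x - z) / d + r * Complex.I) with hR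
  have hnear_re : ∀ t, t ≠ 1 / 2 → |t - 1 / 2| ≤ δ → ((τ.branch i t - z) / d).re ≠ 0 :=
    fun t ht htδ h => by simpa [h] using hnear t ht htδ
  have hslit : ∀ j, ∀ t ∈ Icc (0 : ℝ) 1, (j = i → t ≠ 1 / 2) →
      R (τ.branch j t) ∈ Complex.slitPlane := fun j t ht hjt => by
    rcases hsupp j t ht with h | ⟨rfl, h⟩
    · exact mobius_mem_slitPlane_of_lt_norm hr0 (hrm.trans_le (hm' _ h))
    · exact mobius_mem_slitPlane_of_re_ne_zero hr0 (hnear_re t (hjt rfl) h)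
  have hRz : R z = -1 := by
    have : (r : ℂ) * Complex.I ≠ 0 := by simp [hr0.ne']
    simp only [hR, sub_self, zero_div, zero_sub, zero_add]
    rw [neg_div, div_self this]
  have hR0 : ∀ x ∈ support τ.branch, R x ≠ 0 := fun x hx => by
    obtain ⟨j, t, ht, rfl⟩ := mem_iUnion.1 hx
    by_cases h : j = i ∧ t = 1 / 2
    · rw [h.1, h.2, ← hz, hRz]; simp
    · exact Complex.slitPlane_ne_zero (hslit j t ht fun hj ht => h ⟨hj, ht⟩)
  have hnum : ∀ x ∈ support τ.branch, (x - z) / d - r * Complex.I ≠ 0 := fun x hx h =>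
    hR0 x hx (by simp [hR, h])
  have hden : ∀ x ∈ support τ.branch, (x - z) / d + r * Complex.I ≠ 0 := fun x hx h =>
    hR0 x hx (by simp [hR, h])
  have hp : ∀ x, x - (z + r * Complex.I * d) = d * ((x - z) / d - r * Complex.I) := fun x => by
    field_simp; ring
  have hq : ∀ x, x - (z - r * Complex.I * d) = d * ((x - z) / d + r * Complex.I) := fun x => by
    field_simp; ring
  have hpS : z + r * Complex.I * d ∉ support τ.branch := fun h => hnum _ h (by field_simp; ring)
  have hqS : z - r * Complex.I * d ∉ support τ.branch := fun h => hden _ h (by field_simp; ring)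
  have hRq : ∀ x ∈ support τ.branch,
      R x * (x - (z - r * Complex.I * d)) = 1 * (x - (z + r * Complex.I * d)) := fun x hx => by
    have := hden x hx
    rw [hp, hq, one_mul]
    simp only [hR]
    rw [div_mul_eq_mul_div, div_eq_iff this]
    ring
  have hRc : ContinuousOn R (support τ.branch) :=
    ContinuousOn.div (by fun_prop) (by fun_prop) hden
  have hRbc : ∀ j, ContinuousOn (fun t => R (τ.branch j t)) (Icc 0 1) := fun j =>
    hRc.comp (τ.continuous_branch j).continuousOn fun t ht => τ.mem_support ht
  have hturn : ∀ j, j ≠ i → turning τ.branch (z + r * Complex.I * d) j =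
      turning τ.branch (z - r * Complex.I * d) j +
        (Complex.log (R (τ.branch j 1)) - Complex.log (R (τ.branch j 0))) := fun j hj =>
    turning_eq_add (τ.continuous_branch j).continuousOn
      (fun t ht => τ.branch_ne hqS ht) (L := fun t => Complex.log (R (τ.branch j t)))
      ((hRbc j).clog fun t ht => hslit j t ht fun h => (hj h).elim) one_ne_zero (fun t ht => by
        rw [Complex.exp_log (hR0 _ (τ.mem_support ht)), hRq _ (τ.mem_support ht)])
  have hturni : turning τ.branch (z + r * Complex.I * d) i =
      turning τ.branch (z - r * Complex.I * d) i +
        (Complex.log (R (τ.branch i 1)) - Complex.log (R (τ.branch i 0))) +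
          2 * Real.pi * Complex.I := by
    obtain ⟨A, hA, hA'⟩ := exists_log_path (hRbc i) fun t ht => hR0 _ (τ.mem_support ht)
    rw [turning_eq_add (τ.continuous_branch i).continuousOn
      (fun t ht => τ.branch_ne hqS ht) hA one_ne_zero (fun t ht => by
        rw [hA' t ht, hRq _ (τ.mem_support ht)])]
    have hsub : ∀ {a b : ℝ}, 0 ≤ a → b ≤ 1 → Icc a b ⊆ Icc (0 : ℝ) 1 := fun ha hb =>
      Icc_subset_Icc ha hb
    have hside : ∀ a b : ℝ, 0 ≤ a → b ≤ 1 → a ≤ b → (1 / 2 : ℝ) ∉ Icc a b →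
        A b - A a = Complex.log (R (τ.branch i b)) - Complex.log (R (τ.branch i a)) :=
      fun a b ha hb hab h => by
        have hs : ∀ t ∈ Icc a b, R (τ.branch i t) ∈ Complex.slitPlane := fun t ht =>
          hslit i t (hsub ha hb ht) fun _ h' => h (h' ▸ ht)
        refine sub_eq_sub_of_exp_eq hab (hA.mono (hsub ha hb))
          (((hRbc i).mono (hsub ha hb)).clog hs) (C := 1) fun t ht => ?_
        rw [hA' t (hsub ha hb ht), Complex.exp_log (Complex.slitPlane_ne_zero (hs t ht)), one_mul]
    have h1 := hside 0 (1 / 2 - δ) le_rfl (by linarith) (by linarith) fun h => by linarith [h.2]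
    have h3 := hside (1 / 2 + δ) 1 (by linarith) le_rfl (by linarith) fun h => by linarith [h.1]
    have hmid : Icc (1 / 2 - δ) (1 / 2 + δ) ⊆ Icc (0 : ℝ) 1 := hsub (by linarith) (by linarith)
    have hneg : ∀ t ∈ Icc (1 / 2 - δ) (1 / 2 + δ), -R (τ.branch i t) ∈ Complex.slitPlane :=
      fun t ht => by
        by_cases h : t = 1 / 2
        · rw [h, ← hz, hRz]; simp
        · refine Complex.mem_slitPlane_iff.2 (Or.inr ?_)
          have hre := hnear_re t h (abs_le.2 ⟨by linarith [ht.1], by linarith [ht.2]⟩)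
          have h0 := hden _ (τ.mem_support (i := i) (hmid ht))
          rw [Complex.neg_im, neg_ne_zero]
          simp only [hR]
          rw [mobius_im]
          exact div_ne_zero (by simp [hr0.ne', hre]) (by simpa using h0)
    have h2 : A (1 / 2 + δ) - A (1 / 2 - δ) = Complex.log (-R (τ.branch i (1 / 2 + δ))) -
        Complex.log (-R (τ.branch i (1 / 2 - δ))) := by
      refine sub_eq_sub_of_exp_eq (by linarith) (hA.mono hmid)
        (B := fun t => Complex.log (-R (τ.branch i t)))
        (((hRbc i).mono hmid).neg.clog hneg) (C := -1) fun t ht => ?_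
      rw [hA' t (hmid ht), Complex.exp_log (Complex.slitPlane_ne_zero (hneg t ht))]
      ring
    have him1 : 0 < (R (τ.branch i (1 / 2 - δ))).im := by
      have h := hnear (1 / 2 - δ) (by linarith) (by simp [abs_of_pos hδ])
      have h0 := hden _ (τ.mem_support (i := i) (hmid ⟨le_rfl, by linarith⟩))
      simp only [hR]
      rw [mobius_im]
      refine div_pos ?_ (Complex.normSq_pos.2 h0)
      have : ((τ.branch i (1 / 2 - δ) - z) / d).re < 0 :=
        neg_of_mul_pos_right h (by rw [inv_nonpos]; linarith)
      nlinarith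
    have him2 : (R (τ.branch i (1 / 2 + δ))).im < 0 := by
      have h := hnear (1 / 2 + δ) (by linarith) (by simp [abs_of_pos hδ])
      have h0 := hden _ (τ.mem_support (i := i) (hmid ⟨by linarith, le_rfl⟩))
      simp only [hR]
      rw [mobius_im]
      refine div_neg_of_neg_of_pos ?_ (Complex.normSq_pos.2 h0)
      have : 0 < ((τ.branch i (1 / 2 + δ) - z) / d).re :=
        pos_of_mul_pos_right h (by rw [inv_nonneg]; linarith)
      nlinarith
    have hl1 : Complex.log (-R (τ.branch i (1 / 2 - δ))) =
        Complex.log (R (τ.branch i (1 / 2 - δ))) - Real.pi * Complex.I := by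
      rw [Complex.log, Complex.log, norm_neg, Complex.arg_neg_eq_arg_sub_pi_of_im_pos him1]
      push_cast; ring
    have hl2 : Complex.log (-R (τ.branch i (1 / 2 + δ))) =
        Complex.log (R (τ.branch i (1 / 2 + δ))) + Real.pi * Complex.I := by
      rw [Complex.log, Complex.log, norm_neg, Complex.arg_neg_eq_arg_add_pi_of_im_neg him2]
      push_cast; ring
    rw [hl1, hl2] at h2
    linear_combination h1 + h2 + h3
  refine ⟨hpS, hqS, ?_⟩
  have hcob := hv fun x => Complex.log (R x)
  rw [coboundary] at hcob
  classical
  have hall : ∀ j, turning τ.branch (z + r * Complex.I * d) j =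
      turning τ.branch (z - r * Complex.I * d) j +
        (Complex.log (R (τ.branch j 1)) - Complex.log (R (τ.branch j 0))) +
          if j = i then 2 * Real.pi * Complex.I else 0 := fun j => by
    split_ifs with h
    · rw [h]; exact hturni
    · rw [hturn j h, add_zero]
  simp only [winding, hall, mul_add, Finset.sum_add_distrib, hcob, mul_ite, mul_zero,
    Finset.sum_ite_eq', Finset.mem_univ, if_true]
  ring

end Winding

/-! ### Edge paths and signed letter counts -/

section Words

variable {ι X : Type*}

theorem traversal_param_spec {θ : ℝ → ℝ} {s : Bool} {a b : ℝ} (hab : a < b)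
    (h : match s with
      | true => StrictMonoOn θ (Icc a b) ∧ θ a = 0 ∧ θ b = 1
      | false => StrictAntiOn θ (Icc a b) ∧ θ a = 1 ∧ θ b = 0) :
    (∀ t ∈ Icc a b, θ t ∈ Icc (0 : ℝ) 1) ∧ (∀ t ∈ Ioo a b, θ t ∈ Ioo (0 : ℝ) 1) ∧
      (θ a = if s then 0 else 1) ∧ (θ b = if s then 1 else 0) := by
  have ha : a ∈ Icc a b := left_mem_Icc.2 hab.le
  have hb : b ∈ Icc a b := right_mem_Icc.2 hab.le
  cases s with
  | true =>
    obtain ⟨hm, h0, h1⟩ := h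
    refine ⟨fun t ht => ⟨?_, ?_⟩, fun t ht => ⟨?_, ?_⟩, by simpa, by simpa⟩
    · rw [← h0]; exact hm.monotoneOn ha ht ht.1
    · rw [← h1]; exact hm.monotoneOn ht hb ht.2
    · rw [← h0]; exact hm ha (Ioo_subset_Icc_self ht) ht.1
    · rw [← h1]; exact hm (Ioo_subset_Icc_self ht) hb ht.2
  | false =>
    obtain ⟨hm, h0, h1⟩ := h
    refine ⟨fun t ht => ⟨?_, ?_⟩, fun t ht => ⟨?_, ?_⟩, by simpa, by simpa⟩
    · rw [← h1]; exact hm.antitoneOn ht hb ht.2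
    · rw [← h0]; exact hm.antitoneOn ha ht ht.1
    · rw [← h1]; exact hm (Ioo_subset_Icc_self ht) hb ht.2
    · rw [← h0]; exact hm ha (Ioo_subset_Icc_self ht) ht.1

theorem Traverses.exists_param {γ c : ℝ → X} {s : Bool} {a b : ℝ} (h : Traverses γ c s a b) :
    ∃ θ : ℝ → ℝ, ContinuousOn θ (Icc a b) ∧ (∀ t ∈ Icc a b, θ t ∈ Icc (0 : ℝ) 1) ∧
      (∀ t ∈ Ioo a b, θ t ∈ Ioo (0 : ℝ) 1) ∧ (∀ t ∈ Icc a b, γ t = c (θ t)) ∧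
      (θ a = if s then 0 else 1) ∧ (θ b = if s then 1 else 0) := by
  obtain ⟨-, hab, -, θ, hθ, heq, h⟩ := h
  obtain ⟨h1, h2, h3⟩ := traversal_param_spec hab h
  exact ⟨θ, hθ, h1, h2, heq, h3⟩

theorem Traverses.startPt_endPt {e : ι → ℝ → ℂ} {γ : ℝ → ℂ} {x : ι × Bool} {a b : ℝ}
    (h : Traverses γ (e x.1) x.2 a b) : γ a = startPt e x ∧ γ b = endPt e x := by
  have hab := h.2.1.le
  obtain ⟨θ, -, -, -, heq, h0, h1⟩ := h.exists_param
  obtain ⟨i, s⟩ := x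
  rw [heq a (left_mem_Icc.2 hab), heq b (right_mem_Icc.2 hab), h0, h1]
  cases s <;> simp [startPt, endPt]

theorem startPt_mem_switches (e : ι → ℝ → ℂ) (x : ι × Bool) : startPt e x ∈ switches e := by
  obtain ⟨i, _ | _⟩ := x
  · exact Or.inr ⟨i, rfl⟩
  · exact Or.inl ⟨i, rfl⟩

theorem endPt_mem_switches (e : ι → ℝ → ℂ) (x : ι × Bool) : endPt e x ∈ switches e := by
  obtain ⟨i, _ | _⟩ := x
  · exact Or.inl ⟨i, rfl⟩
  · exact Or.inr ⟨i, rfl⟩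

theorem TracesWord.le {e : ι → ℝ → X} {γ : ℝ → X} {w : List (ι × Bool)} :
    ∀ {a b : ℝ}, TracesWord e γ a w b → a ≤ b := by
  induction w with
  | nil => exact fun h => le_of_eq h
  | cons x w ih => exact fun ⟨c, h1, h2⟩ => h1.2.1.le.trans (ih h2)

theorem TracesWord.mem_switches {e : ι → ℝ → ℂ} {γ : ℝ → ℂ} {w : List (ι × Bool)} :
    ∀ {a b : ℝ}, a < b → TracesWord e γ a w b → γ a ∈ switches e ∧ γ b ∈ switches e := by
  induction w with
  | nil => exact fun hab h => (hab.ne h).elim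
  | cons x w ih =>
    rintro a b - ⟨c, h1, h2⟩
    refine ⟨h1.startPt_endPt.1 ▸ startPt_mem_switches e x, ?_⟩
    rcases h2.le.eq_or_lt with rfl | hcb
    · exact h1.startPt_endPt.2 ▸ endPt_mem_switches e x
    · exact (ih hcb h2).2

theorem TracesWord.mem_support {e : ι → ℝ → ℂ} {γ : ℝ → ℂ} {w : List (ι × Bool)} :
    ∀ {a b : ℝ}, a < b → TracesWord e γ a w b → ∀ t ∈ Icc a b, γ t ∈ support e := by
  induction w with
  | nil => exact fun hab h => (hab.ne h).elim
  | cons x w ih =>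
    rintro a b - ⟨c, h1, h2⟩ t ht
    rcases le_or_gt t c with htc | htc
    · obtain ⟨θ, -, hθ, -, heq, -⟩ := h1.exists_param
      rw [heq t ⟨ht.1, htc⟩]
      exact mem_iUnion.2 ⟨_, _, hθ t ⟨ht.1, htc⟩, rfl⟩
    · exact ih (htc.trans_le ht.2) h2 t ⟨htc.le, ht.2⟩

theorem TracesWord.ne_nil {e : ι → ℝ → X} {γ : ℝ → X} {w : List (ι × Bool)}
    (h : TracesWord e γ 0 w 1) : w ≠ [] := by
  rintro rfl
  exact zero_ne_one h

theorem TracesWord.startPt_head {e : ι → ℝ → ℂ} {γ : ℝ → ℂ} {w : List (ι × Bool)} {a b : ℝ}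
    (h : TracesWord e γ a w b) : ∀ x ∈ w.head?, γ a = startPt e x := by
  cases w with
  | nil => simp
  | cons x w =>
    obtain ⟨d, h1, -⟩ := h
    intro y hy
    obtain rfl : x = y := by simpa using hy
    exact h1.startPt_endPt.1

theorem TracesWord.endPt_getLast {e : ι → ℝ → ℂ} {γ : ℝ → ℂ} {w : List (ι × Bool)} :
    ∀ {a b : ℝ}, TracesWord e γ a w b → ∀ x ∈ w.getLast?, γ b = endPt e x := by
  induction w with
  | nil => simp
  | cons x w ih =>
    rintro a b ⟨d, h1, h2⟩ y hy
    cases w with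
    | nil =>
      rw [← show d = b from h2]
      obtain rfl : x = y := by simpa using hy
      exact h1.startPt_endPt.2
    | cons z w => exact ih h2 y (by simpa [List.getLast?_cons_cons] using hy)

/-- The sign of a letter: `1` if the branch is run along its orientation, `-1` otherwise. -/
def letterSign (s : Bool) : ℂ := if s then 1 else -1

open Classical in
/-- The matrix of the action on chains of the edge map with words `W`: its entries are the
occurrences counted with sign. -/
noncomputable def signedMatrix (W : ι → List (ι × Bool)) : Matrix ι ι ℂ :=
  Matrix.of fun i j => ((W j).countP (· = (i, true)) : ℂ) - (W j).countP (· = (i, false))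

theorem signedMatrix_apply_eq_sum [DecidableEq ι] (W : ι → List (ι × Bool)) (i j : ι) :
    signedMatrix W i j =
      ((W j).map fun x => letterSign x.2 * if x.1 = i then 1 else 0).sum := by
  rw [signedMatrix, Matrix.of_apply]
  induction W j with
  | nil => simp
  | cons x w ih =>
    rw [List.map_cons, List.sum_cons, ← ih, List.countP_cons, List.countP_cons]
    obtain ⟨k, _ | _⟩ := x <;> by_cases h : k = i <;> simp [h, letterSign] <;> ring

theorem sum_mulVec_signedMatrix [Fintype ι] (W : ι → List (ι × Bool)) (v u : ι → ℂ) :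
    ∑ i, (signedMatrix W).mulVec v i * u i =
      ∑ j, v j * ((W j).map fun x => letterSign x.2 * u x.1).sum := by
  classical
  have h : ∀ j, ∑ i, signedMatrix W i j * u i =
      ((W j).map fun x => letterSign x.2 * u x.1).sum := fun j => by
    simp only [signedMatrix_apply_eq_sum]
    induction W j with
    | nil => simp
    | cons x w ih =>
      simp only [List.map_cons, List.sum_cons, add_mul, Finset.sum_add_distrib, ih]
      simp
  simp only [← h, Matrix.mulVec, dotProduct, Finset.sum_mul, Finset.mul_sum]
  rw [Finset.sum_comm]
  exact Finset.sum_congr rfl fun _ _ => Finset.sum_congr rfl fun _ _ => by ring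

theorem TracesWord.sum_eq {e : ι → ℝ → X} {γ : ℝ → X} {A : ℝ → ℂ} {u : ι → ℂ}
    (h : ∀ (x : ι × Bool) (p q : ℝ), Traverses γ (e x.1) x.2 p q →
      A q - A p = letterSign x.2 * u x.1) {w : List (ι × Bool)} :
    ∀ {a b : ℝ}, TracesWord e γ a w b →
      (w.map fun x => letterSign x.2 * u x.1).sum = A b - A a := by
  induction w with
  | nil => intro a b hw; rw [show a = b from hw]; simp
  | cons x w ih =>
    rintro a b ⟨c, h1, h2⟩
    rw [List.map_cons, List.sum_cons, ih h2, ← h x a c h1]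
    ring

end Words

section TrackWords

variable {ι : Type*} [Fintype ι] {n : ℕ} {D : PuncturedDisk n} {τ : TrainTrack D ι}

/-- Two traversals by one path either coincide or do not overlap. -/
theorem Traverses.eq_or_le {γ : ℝ → ℂ} {i k : ι} {s s' : Bool} {a c p q : ℝ}
    (h1 : Traverses γ (τ.branch i) s a c) (h2 : Traverses γ (τ.branch k) s' p q) (hap : a ≤ p) :
    (p = a ∧ q = c ∧ k = i) ∨ c ≤ p := by
  have hac := h1.2.1
  have hpq := h2.2.1
  obtain ⟨θ, -, hθ, hθi, heq, -, hθc⟩ := h1.exists_param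
  obtain ⟨θ', -, hθ', hθi', heq', h0', h1'⟩ := h2.exists_param
  refine or_iff_not_imp_right.2 fun hpc => ?_
  rw [not_le] at hpc
  have hpa : p = a := by
    by_contra hne
    have hp : p ∈ Ioo a c := ⟨lt_of_le_of_ne hap (Ne.symm hne), hpc⟩
    have hp' : p ∈ Icc p q := left_mem_Icc.2 hpq.le
    have := (τ.embedded i k _ (hθi p hp) _ (hθ' p hp')
      ((heq p (Ioo_subset_Icc_self hp)).symm.trans (heq' p hp'))).2
    have h3 := hθi p hp
    rw [this, h0'] at h3
    cases s' <;> simp at h3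
  subst hpa
  have hqc : q = c := by
    rcases lt_trichotomy q c with hlt | h | hlt
    · have hq : q ∈ Ioo p c := ⟨hpq, hlt⟩
      have hq' : q ∈ Icc p q := right_mem_Icc.2 hpq.le
      have := (τ.embedded i k _ (hθi q hq) _ (hθ' q hq')
        ((heq q (Ioo_subset_Icc_self hq)).symm.trans (heq' q hq'))).2
      have h3 := hθi q hq
      rw [this, h1'] at h3
      cases s' <;> simp at h3
    · exact h
    · have hq : c ∈ Ioo p q := ⟨hac, hlt⟩
      have hq' : c ∈ Icc p c := right_mem_Icc.2 hac.le
      have := (τ.embedded k i _ (hθi' c hq) _ (hθ c hq')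
        ((heq' c (Ioo_subset_Icc_self hq)).symm.trans (heq c hq'))).2
      have h3 := hθi' c hq
      rw [this, hθc] at h3
      cases s <;> simp at h3
  subst hqc
  have hm : (p + q) / 2 ∈ Ioo p q := ⟨by linarith, by linarith⟩
  exact ⟨rfl, rfl, ((τ.embedded i k _ (hθi _ hm) _ (hθ' _ (Ioo_subset_Icc_self hm))
    ((heq _ (Ioo_subset_Icc_self hm)).symm.trans (heq' _ (Ioo_subset_Icc_self hm)))).1).symm⟩

theorem TracesWord.eq_singleton {γ : ℝ → ℂ} {k : ι} {s : Bool} {w : List (ι × Bool)}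
    (h : TracesWord τ.branch γ 0 w 1) (hk : Traverses γ (τ.branch k) s 0 1) :
    ∃ s', w = [(k, s')] := by
  cases w with
  | nil => exact (zero_ne_one h).elim
  | cons x w =>
    obtain ⟨c, h1, h2⟩ := h
    rcases h1.eq_or_le hk le_rfl with ⟨-, hc, hx⟩ | h
    · subst hc hx
      cases w with
      | nil => exact ⟨x.2, rfl⟩
      | cons y w =>
        obtain ⟨c, h3, -⟩ := h2
        exact (h3.2.1.not_ge h3.2.2.1).elim
    · exact (h.not_gt h1.2.1).elim

variable {G : ℂ → ℂ} {W : ι → List (ι × Bool)}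
  (hW : ∀ j, TracesWord τ.branch (fun t => G (τ.branch j t)) 0 (W j) 1)
include hW

theorem mapsTo_switches : MapsTo G (switches τ.branch) (switches τ.branch) := by
  rintro _ (⟨j, rfl⟩ | ⟨j, rfl⟩)
  · exact ((hW j).mem_switches zero_lt_one).1
  · exact ((hW j).mem_switches zero_lt_one).2

theorem coboundary_mulVec (v : ι → ℂ) (h : ℂ → ℂ) :
    coboundary τ.branch ((signedMatrix W).mulVec v) h = coboundary τ.branch v (h ∘ G) := by
  rw [coboundary, coboundary,
    sum_mulVec_signedMatrix W v fun i => h (τ.branch i 1) - h (τ.branch i 0)]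
  refine Finset.sum_congr rfl fun j _ => ?_
  rw [TracesWord.sum_eq (A := fun t => h (G (τ.branch j t)))
    (u := fun i => h (τ.branch i 1) - h (τ.branch i 0)) (fun x p q hx => ?_) (hW j)]
  · rfl
  · rw [hx.startPt_endPt.1, hx.startPt_endPt.2]
    obtain ⟨i, _ | _⟩ := x <;> simp [startPt, endPt, letterSign]

theorem winding_mulVec {v : ι → ℂ} (hv : IsCycle τ.branch v) {p q : ℂ}
    (hp : p ∉ support τ.branch) (hq : q ∉ support τ.branch) {l : ℂ → ℂ}
    (hl : ContinuousOn l (support τ.branch))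
    (h : ∀ x ∈ support τ.branch, Complex.exp (l x) * (x - q) = G x - p) :
    winding τ.branch ((signedMatrix W).mulVec v) p = winding τ.branch v q := by
  have key : ∀ j, ((W j).map fun x => letterSign x.2 * turning τ.branch p x.1).sum =
      turning τ.branch q j + (l (τ.branch j 1) - l (τ.branch j 0)) := fun j => by
    obtain ⟨A, hA, hA'⟩ := exists_log_path (γ := fun t => τ.branch j t - q)
      ((τ.continuous_branch j).continuousOn.sub continuousOn_const)
      fun t ht => sub_ne_zero.2 (τ.branch_ne hq ht)
    have hlj : ContinuousOn (fun t => l (τ.branch j t)) (Icc 0 1) :=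
      hl.comp (τ.continuous_branch j).continuousOn fun t ht => τ.mem_support ht
    rw [TracesWord.sum_eq (A := A + fun t => l (τ.branch j t)) (u := turning τ.branch p) (fun x a b hx => ?_) (hW j),
      show turning τ.branch q j = A 1 - A 0 from
        logInc_eq one_ne_zero hA fun t ht => by rw [one_mul, hA' t ht]]
    · simp only [Pi.add_apply]; ring
    · obtain ⟨ha, hab, hb, -⟩ := id hx
      obtain ⟨θ, hθc, hθ, -, heq, h0, h1⟩ := hx.exists_param
      have hsub : Icc a b ⊆ Icc (0 : ℝ) 1 := Icc_subset_Icc ha hb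
      obtain ⟨B, hB, hB'⟩ := exists_log_path (γ := fun t => τ.branch x.1 t - p)
        ((τ.continuous_branch x.1).continuousOn.sub continuousOn_const)
        fun t ht => sub_ne_zero.2 (τ.branch_ne hp ht)
      rw [sub_eq_sub_of_exp_eq hab.le ((hA.add hlj).mono hsub) (B := fun t => B (θ t))
        (hB.comp hθc hθ) (C := 1) fun t ht => ?_,
        show turning τ.branch p x.1 = B 1 - B 0 from
          logInc_eq one_ne_zero hB fun t ht => by rw [one_mul, hB' t ht], h0, h1]
      · cases x.2 <;> simp [letterSign]
      · rw [Pi.add_apply, Complex.exp_add, hA' t (hsub ht), one_mul, hB' _ (hθ t ht), ← heq t ht,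
          ← h _ (τ.mem_support (hsub ht)), mul_comm]
  have h2 := hv l
  rw [coboundary] at h2
  rw [winding, winding, sum_mulVec_signedMatrix]
  simp only [key, mul_add, Finset.sum_add_distrib, h2, add_zero]

end TrackWords

/-! ### Homotopies off a point -/

theorem norm_le_one_of_eq_self {g : ℂ ≃ₜ ℂ} (hg : ∀ x, 1 ≤ ‖x‖ → g x = x) {x : ℂ} (hx : ‖x‖ ≤ 1) :
    ‖g x‖ ≤ 1 := by
  by_contra h
  have := g.injective (hg (g x) (not_le.1 h).le)
  rw [this] at h
  exact h hx

theorem norm_symm_le_one_of_eq_self {g : ℂ ≃ₜ ℂ} (hg : ∀ x, 1 ≤ ‖x‖ → g x = x) {x : ℂ}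
    (hx : ‖x‖ ≤ 1) : ‖g.symm x‖ ≤ 1 :=
  norm_le_one_of_eq_self (fun y hy => by rw [g.symm_apply_eq, hg y hy]) hx

/-- A homeomorphism of the plane which is the identity outside the unit disk does not turn the
direction of chords: by the Alexander trick, `x ↦ s • g (s⁻¹ • x)`, it is isotopic to the
identity. -/
theorem exists_log_chord {g : ℂ ≃ₜ ℂ} (hg : ∀ x, 1 ≤ ‖x‖ → g x = x) {S : Set ℂ} (hS : IsCompact S)
    {q : ℂ} (hq : q ∉ S) :
    ∃ l : ℂ → ℂ, ContinuousOn l S ∧ ∀ x ∈ S, Complex.exp (l x) * (x - q) = g x - g q := by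
  set A : ℝ × ℂ → ℂ := fun p => if p.1 = 0 then p.2 else p.1 • g (p.1⁻¹ • p.2) with hA
  have hbound : ∀ s : ℝ, 0 ≤ s → ∀ x, ‖A (s, x) - x‖ ≤ 2 * s := fun s hs x => by
    rcases hs.eq_or_lt with rfl | hs
    · simp [hA]
    have hA' : A (s, x) = s • g (s⁻¹ • x) := by simp [hA, hs.ne']
    rw [hA']
    rcases le_total 1 ‖s⁻¹ • x‖ with h | h
    · rw [hg _ h, smul_inv_smul₀ hs.ne']
      simp [hs.le]
    · have h1 : ‖s • g (s⁻¹ • x)‖ ≤ s := by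
        rw [norm_smul, Real.norm_of_nonneg hs.le]
        exact mul_le_of_le_one_right hs.le (norm_le_one_of_eq_self hg h)
      have h2 : ‖x‖ ≤ s := by
        rwa [norm_smul, norm_inv, Real.norm_of_nonneg hs.le, inv_mul_le_iff₀ hs, mul_one] at h
      linarith [norm_sub_le (s • g (s⁻¹ • x)) x]
  have hcont : ContinuousOn A (Icc 0 1 ×ˢ univ) := by
    rintro ⟨s, x⟩ ⟨hs, -⟩
    rcases hs.1.eq_or_lt with h | h
    · simp only at h
      subst h
      have hx : A (0, x) = x := by simp [hA]
      rw [ContinuousWithinAt, hx]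
      have h1 : Filter.Tendsto (fun p : ℝ × ℂ => p.2) (𝓝[Icc 0 1 ×ˢ univ] ((0 : ℝ), x)) (𝓝 x) :=
        (continuous_snd.tendsto' (0, x) x rfl).mono_left inf_le_left
      have h2 : Filter.Tendsto (fun p : ℝ × ℂ => A p - p.2)
          (𝓝[Icc 0 1 ×ˢ univ] ((0 : ℝ), x)) (𝓝 0) := by
        have h3 : Continuous fun p : ℝ × ℂ => 2 * p.1 := by fun_prop
        refine squeeze_zero_norm' (a := fun p : ℝ × ℂ => 2 * p.1) ?_
          ((h3.tendsto' (0, x) 0 (by simp)).mono_left inf_le_left)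
        filter_upwards [self_mem_nhdsWithin] with p hp
        exact hbound p.1 hp.1.1 p.2
      simpa using h2.add h1
    · have h1 : ContinuousAt (fun p : ℝ × ℂ => p.1 • g (p.1⁻¹ • p.2)) (s, x) := by
        have h2 : ContinuousAt (fun p : ℝ × ℂ => p.1⁻¹ • p.2) (s, x) :=
          (continuousAt_fst.inv₀ h.ne').smul continuousAt_snd
        exact continuousAt_fst.smul
          (ContinuousAt.comp (f := fun p : ℝ × ℂ => p.1⁻¹ • p.2) g.continuous.continuousAt h2)
      refine (h1.congr ?_).continuousWithinAt
      have h0 : ∀ᶠ p : ℝ × ℂ in 𝓝 (s, x), 0 < p.1 :=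
        continuous_fst.continuousAt.eventually_const_lt h
      filter_upwards [h0] with p hp
      simp [hA, hp.ne']
  have hinj : ∀ s x y, A (s, x) = A (s, y) → x = y := fun s x y h => by
    by_cases hs : s = 0
    · simpa [hA, hs] using h
    · simp only [hA, hs, if_false] at h
      exact smul_right_injective ℂ (inv_ne_zero hs) (g.injective (smul_right_injective ℂ hs h))
  have hne : ∀ x ∈ S, x ≠ q := fun x hx h => hq (h ▸ hx)
  obtain ⟨l, hl, hl'⟩ := exists_log_of_homotopy hS
    (K := fun p => (A (p.1, p.2) - A (p.1, q)) / (p.2 - q))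
    (ContinuousOn.div ((hcont.comp (by fun_prop) fun p hp => ⟨hp.1, mem_univ _⟩).sub
      (hcont.comp (by fun_prop) fun p hp => ⟨hp.1, mem_univ _⟩)) (by fun_prop)
      fun p hp => sub_ne_zero.2 (hne _ hp.2))
    (fun p hp => div_ne_zero (sub_ne_zero.2 fun h => hne _ hp.2 (hinj _ _ _ h))
      (sub_ne_zero.2 (hne _ hp.2)))
    (fun x hx => by simp [hA, div_self (sub_ne_zero.2 (hne x hx))])
  refine ⟨l, hl, fun x hx => ?_⟩
  rw [hl' x hx, div_mul_cancel₀ _ (sub_ne_zero.2 (hne x hx))]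
  simp [hA]

theorem face_subset {ι : Type*} (e : ι → ℝ → ℂ) (x : ℂ) : face e x ⊆ closedBall 0 1 \ support e :=
  connectedComponentIn_subset _ _

/-! ### Eigenvalues of the action on chains -/

section Eigenvalues

variable {ι : Type*} [Fintype ι] {n : ℕ} {D : PuncturedDisk n} {τ : TrainTrack D ι}
  {N : FibredNhd τ}

/-- The retraction moves points inside the neighbourhood, hence without winding about a point
outside it. -/
theorem FibredNhd.exists_log_retr (N : FibredNhd τ) {g : ℂ → ℂ} (hgc : Continuous g) {S : Set ℂ}
    (hS : IsCompact S) (hg : MapsTo g S N.carrier) {p : ℂ} (hp : p ∉ N.carrier) :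
    ∃ l : ℂ → ℂ, ContinuousOn l S ∧
      ∀ x ∈ S, Complex.exp (l x) * (g x - p) = N.retr (g x) - p := by
  obtain ⟨H, hH, hH1, hH2, -⟩ := N.deformation
  have hne : ∀ x ∈ N.carrier, x - p ≠ 0 := fun x hx h => hp (sub_eq_zero.1 h ▸ hx)
  obtain ⟨l, hl, hl'⟩ := exists_log_of_homotopy hS
    (K := fun y => (H (y.1, g y.2) - p) / (g y.2 - p))
    (ContinuousOn.div ((hH.comp (by fun_prop) fun y hy => ⟨hy.1, hg hy.2⟩).sub continuousOn_const)
      (by fun_prop) fun y hy => hne _ (hg hy.2))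
    (fun y hy => div_ne_zero (hne _ (hH2 _ hy.1 _ (hg hy.2)).1) (hne _ (hg hy.2)))
    (fun x hx => by
      simp only
      rw [(hH1 _ (hg hx)).1, div_self (hne _ (hg hx))])
  refine ⟨l, hl, fun x hx => ?_⟩
  rw [hl' x hx, div_mul_cancel₀ _ (hne _ (hg hx)), (hH1 _ (hg hx)).2]

theorem FibredNhd.support_subset_interior (N : FibredNhd τ) :
    support τ.branch ⊆ interior N.carrier := subset_interior_iff_mem_nhdsSet.2 N.mem_nhdsSet

theorem FibredNhd.support_subset (N : FibredNhd τ) : support τ.branch ⊆ N.carrier :=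
  N.support_subset_interior.trans interior_subset

theorem _root_.IsCompact.finite_image_of_eventually_eq {α β : Type*} [TopologicalSpace α]
    {s : Set α} (hs : IsCompact s) {f : α → β} (hf : ∀ x ∈ s, ∀ᶠ y in 𝓝 x, f y = f x) :
    (f '' s).Finite := by
  refine hs.induction_on (p := fun t => (f '' t).Finite) (by simp)
    (fun _ _ hst ht => ht.subset (image_mono hst))
    (fun _ _ h1 h2 => by rw [image_union]; exact h1.union h2) fun x hx => ?_
  refine ⟨{y | f y = f x}, mem_nhdsWithin_of_mem_nhds (hf x hx),
    (finite_singleton (f x)).subset ?_⟩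
  rintro _ ⟨y, hy, rfl⟩
  exact hy

theorem eq_zero_or_isUnityRoot_of_pow_eq {z : ℂ} {k l : ℕ} (hkl : k ≠ l) (h : z ^ k = z ^ l) :
    z = 0 ∨ IsUnityRoot z := by
  wlog hlt : k < l generalizing k l
  · exact this hkl.symm h.symm (lt_of_le_of_ne (not_lt.1 hlt) hkl.symm)
  refine or_iff_not_imp_left.2 fun h0 => ⟨l - k, Nat.sub_pos_of_lt hlt, ?_⟩
  rw [← Nat.add_sub_cancel' hlt.le, pow_add] at h
  exact (mul_eq_left₀ (pow_ne_zero k h0)).1 h.symm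

theorem eq_zero_or_isUnityRoot_of_mapsTo {z a : ℂ} {A : Set ℂ} (hA : A.Finite) (ha : a ∈ A)
    (ha0 : a ≠ 0) (hz : ∀ x ∈ A, z * x ∈ A) : z = 0 ∨ IsUnityRoot z := by
  have hmem : ∀ k : ℕ, z ^ k * a ∈ A := fun k => by
    induction k with
    | zero => simpa
    | succ k ih => rw [pow_succ', mul_assoc]; exact hz _ ih
  have := hA.to_subtype
  obtain ⟨k, l, hkl, h⟩ := Finite.exists_ne_map_eq_of_infinite fun k : ℕ => (⟨_, hmem k⟩ : A)
  exact eq_zero_or_isUnityRoot_of_pow_eq hkl (mul_right_cancel₀ ha0 (congrArg Subtype.val h))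

/-- A nonzero cycle has a nonzero winding number about some point off the neighbourhood. -/
theorem IsCycle.exists_winding_ne_zero (N : FibredNhd τ) {v : ι → ℂ} (hv : IsCycle τ.branch v)
    (hv0 : v ≠ 0) : ∃ p ∈ closedBall (0 : ℂ) 1 \ N.carrier, winding τ.branch v p ≠ 0 := by
  obtain ⟨i, hi⟩ := Function.ne_iff.1 hv0
  obtain ⟨r₀, hr₀, h⟩ := exists_winding_sub_winding hv i
  obtain ⟨hp, hq, hpq⟩ := h (r₀ / 2) ⟨by linarith, by linarith⟩
  obtain ⟨q, hqS, hq0⟩ : ∃ q, q ∉ support τ.branch ∧ winding τ.branch v q ≠ 0 := by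
    by_contra! hcon
    rw [hcon _ hp, hcon _ hq, sub_zero] at hpq
    exact mul_ne_zero Complex.two_pi_I_ne_zero hi hpq.symm
  have hq1 : q ∈ closedBall (0 : ℂ) 1 \ support τ.branch := by
    refine ⟨mem_closedBall_zero_iff.2 ?_, hqS⟩
    by_contra h1
    exact hq0 (winding_eq_zero_of_one_le_norm hv (not_le.1 h1).le)
  obtain ⟨p, hpf, hpN⟩ := (N.compl_connected q hq1).nonempty
  exact ⟨p, ⟨(face_subset _ _ hpf).1, hpN⟩, by rwa [winding_eq_of_mem_face hv hq1 hpf]⟩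

variable {g : ℂ ≃ₜ ℂ} (hg : ∀ x, 1 ≤ ‖x‖ → g x = x) (hgN : MapsTo g (support τ.branch) N.carrier)
  {W : ι → List (ι × Bool)}
  (hW : ∀ j, TracesWord τ.branch (fun t => N.retr (g (τ.branch j t))) 0 (W j) 1)

include hW in
/-- On an eigenvector with nonzero boundary the eigenvalue is one of the action on the finite set
of switches. -/
theorem eigenvalue_of_not_isCycle {v : ι → ℂ} {z : ℂ}
    (hz : (signedMatrix W).mulVec v = z • v) (hv : ¬ IsCycle τ.branch v) :
    z = 0 ∨ IsUnityRoot z := by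
  obtain ⟨h, hh⟩ := not_forall.1 hv
  set G : ℂ → ℂ := fun x => N.retr (g x) with hG
  have hGS : MapsTo G (switches τ.branch) (switches τ.branch) := mapsTo_switches hW
  have hsmul : ∀ f, coboundary τ.branch (z • v) f = z * coboundary τ.branch v f := fun f => by
    simp [coboundary, Finset.mul_sum, mul_assoc]
  have hpow : ∀ k : ℕ, z ^ k * coboundary τ.branch v h = coboundary τ.branch v (h ∘ G^[k]) := by
    intro k
    induction k with
    | zero => simp
    | succ k ih =>
      rw [pow_succ', mul_assoc, ih, ← hsmul, ← hz, coboundary_mulVec (G := G) hW,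
        Function.iterate_succ, Function.comp_assoc]
  have : Finite (switches τ.branch) := τ.finite_switches
  obtain ⟨k, l, hkl, heq⟩ :=
    Finite.exists_ne_map_eq_of_infinite fun k : ℕ => (hGS.iterate k).restrict
  refine eq_zero_or_isUnityRoot_of_pow_eq hkl (mul_right_cancel₀ hh ?_)
  have heq' : ∀ x ∈ switches τ.branch, G^[k] x = G^[l] x := fun x hx =>
    congrArg Subtype.val (congrFun heq ⟨x, hx⟩)
  rw [hpow, hpow]
  refine Finset.sum_congr rfl fun j _ => ?_
  simp only [Function.comp_apply]
  rw [heq' _ (Or.inl ⟨j, rfl⟩), heq' _ (Or.inr ⟨j, rfl⟩)]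

include hg hgN hW in
/-- On a cycle the winding numbers about points off the neighbourhood take finitely many values,
and multiplication by the eigenvalue replaces the winding number about `p` by the one about the
preimage of `p`. -/
theorem eigenvalue_of_isCycle {v : ι → ℂ} {z : ℂ} (hz : (signedMatrix W).mulVec v = z • v)
    (hv : IsCycle τ.branch v) (hv0 : v ≠ 0) : z = 0 ∨ IsUnityRoot z := by
  obtain ⟨a, ha, ha0⟩ := hv.exists_winding_ne_zero N hv0
  have hnot : ∀ p, p ∉ interior N.carrier → p ∉ support τ.branch := fun p hp h =>
    hp (N.support_subset_interior h)
  have hfin : (winding τ.branch v '' (closedBall (0 : ℂ) 1 \ N.carrier)).Finite := by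
    refine (IsCompact.finite_image_of_eventually_eq
      ((isCompact_closedBall (0 : ℂ) 1).diff isOpen_interior)
      fun x hx => winding_eventually_eq hv (hnot x hx.2)).subset
      (image_mono (sdiff_subset_sdiff_right interior_subset))
  refine eq_zero_or_isUnityRoot_of_mapsTo hfin (mem_image_of_mem _ ha) ha0 ?_
  rintro _ ⟨p, hp, rfl⟩
  have hpS : p ∉ support τ.branch := fun h => hp.2 (N.support_subset h)
  have hqS : g.symm p ∉ support τ.branch := fun h => hp.2 (by simpa using hgN h)
  have hq : g.symm p ∈ closedBall (0 : ℂ) 1 \ support τ.branch :=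
    ⟨mem_closedBall_zero_iff.2 (norm_symm_le_one_of_eq_self hg (mem_closedBall_zero_iff.1 hp.1)),
      hqS⟩
  obtain ⟨p', hpf, hpN⟩ := (N.compl_connected _ hq).nonempty
  refine ⟨p', ⟨(face_subset _ _ hpf).1, hpN⟩, ?_⟩
  obtain ⟨l, hl, hl'⟩ := exists_log_chord hg τ.isCompact_support hqS
  obtain ⟨l₂, hl₂, hl₂'⟩ := N.exists_log_retr g.continuous τ.isCompact_support hgN hp.2
  have key := winding_mulVec (G := fun x => N.retr (g x)) hW hv hpS hqS (l := fun x => l₂ x + l x)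
    (hl₂.add hl) fun x hx => by
      rw [Complex.exp_add, mul_assoc, hl' x hx, g.apply_symm_apply, hl₂' x hx]
  rw [winding_eq_of_mem_face hv hq hpf, ← key, hz]
  simp [winding, Finset.mul_sum, mul_assoc]

include hg hgN hW in
theorem eigenvalue_signedMatrix {v : ι → ℂ} {z : ℂ} (hz : (signedMatrix W).mulVec v = z • v)
    (hv0 : v ≠ 0) : z = 0 ∨ IsUnityRoot z := by
  by_cases hv : IsCycle τ.branch v
  · exact eigenvalue_of_isCycle hg hgN hW hz hv hv0
  · exact eigenvalue_of_not_isCycle hW hz hv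

theorem winding_eq_zero_of_segment {v : ι → ℂ} (hv : IsCycle τ.branch v) {i : ι}
    (hi : ¬ IsInfinitesimal τ i) {w : ℂ} {r : ℝ} (hr : 0 < r)
    (hseg : ∀ s ∈ Ioc 0 r,
      τ.branch i (1 / 2) + s * w ∈ closedBall (0 : ℂ) 1 \ support τ.branch) :
    winding τ.branch v (τ.branch i (1 / 2) + r * w) = 0 := by
  have hx := hseg r ⟨hr, le_rfl⟩
  have hc : Continuous fun s : ℝ => τ.branch i (1 / 2) + s * w := by fun_prop
  have hsub : (fun s : ℝ => τ.branch i (1 / 2) + s * w) '' Ioc 0 r ⊆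
      face τ.branch (τ.branch i (1 / 2) + r * w) :=
    (isPreconnected_Ioc.image _ hc.continuousOn).subset_connectedComponentIn
      ⟨r, ⟨hr, le_rfl⟩, rfl⟩ (image_subset_iff.2 hseg)
  have hcl : τ.branch i (1 / 2) ∈ closure (face τ.branch (τ.branch i (1 / 2) + r * w)) := by
    refine closure_mono hsub (image_closure_subset_closure_image hc ⟨0, ?_, by simp⟩)
    rw [closure_Ioc hr.ne]
    exact ⟨le_rfl, hr.le⟩
  have hdisj : ¬ Disjoint (face τ.branch (τ.branch i (1 / 2) + r * w)) (sphere 0 1) := fun h =>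
    hi ⟨_, hx, h, _, ⟨1 / 2, ⟨by norm_num, by norm_num⟩, rfl⟩, hcl⟩
  obtain ⟨y, hy, hy1⟩ := not_disjoint_iff.1 hdisj
  rw [← winding_eq_of_mem_face hv hx hy]
  exact winding_eq_zero_of_one_le_norm hv (mem_sphere_zero_iff_norm.1 hy1).ge

/-- A cycle is supported on the infinitesimal branches: both sides of a main branch lie in the
exterior region, about whose points a cycle does not wind. -/
theorem IsCycle.apply_eq_zero {v : ι → ℂ} (hv : IsCycle τ.branch v) {i : ι}
    (hi : ¬ IsInfinitesimal τ i) : v i = 0 := by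
  obtain ⟨r₀, hr₀, h⟩ := exists_winding_sub_winding hv i
  set x := τ.branch i (1 / 2) with hx
  set d := deriv (τ.branch i) (1 / 2) with hd
  have hd0 : 0 < ‖d‖ := norm_pos_iff.2 (τ.deriv_ne_zero i _ ⟨by norm_num, by norm_num⟩)
  have hx1 : ‖x‖ < 1 := (τ.subset_interior i _ ⟨by norm_num, by norm_num⟩).1
  set r := min (r₀ / 2) ((1 - ‖x‖) / ‖d‖) with hr
  have hr0 : 0 < r := lt_min (by linarith) (div_pos (by linarith) hd0)
  have hrr : r < r₀ := (min_le_left _ _).trans_lt (by linarith)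
  have hball : ∀ s ∈ Ioc 0 r, ∀ w : ℂ, ‖w‖ = ‖d‖ → x + s * w ∈ closedBall (0 : ℂ) 1 :=
    fun s hs w hw => by
      have h1 : s * ‖d‖ ≤ 1 - ‖x‖ := (le_div_iff₀ hd0).1 (hs.2.trans (min_le_right _ _))
      rw [mem_closedBall_zero_iff]
      refine (norm_add_le _ _).trans ?_
      rw [norm_mul, Complex.norm_real, Real.norm_of_nonneg hs.1.le, hw]
      linarith
  have hp := winding_eq_zero_of_segment hv hi (w := Complex.I * d) hr0 fun s hs =>
    ⟨hball s hs _ (by simp), by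
      rw [← mul_assoc]; exact (h s ⟨hs.1, hs.2.trans_lt hrr⟩).1⟩
  have hq := winding_eq_zero_of_segment hv hi (w := -(Complex.I * d)) hr0 fun s hs =>
    ⟨hball s hs _ (by simp), by
      rw [mul_neg, ← mul_assoc, ← sub_eq_add_neg]; exact (h s ⟨hs.1, hs.2.trans_lt hrr⟩).2.1⟩
  rw [← mul_assoc] at hp
  rw [mul_neg, ← mul_assoc, ← sub_eq_add_neg] at hq
  have := (h r ⟨hr0, hrr⟩).2.2
  rw [hp, hq, sub_zero] at this
  exact (mul_eq_zero.1 this.symm).resolve_left Complex.two_pi_I_ne_zero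

include hg hgN hW in
/-- For a regular track the signed matrix is injective: a vector in its kernel is a cycle because
the switches are mapped injectively, hence is supported on the infinitesimal branches, which are
permuted. -/
theorem IsRegularFor.isUnityRoot (hreg : IsRegularFor τ N g) {v : ι → ℂ} {z : ℂ}
    (hz : (signedMatrix W).mulVec v = z • v) (hv0 : v ≠ 0) : IsUnityRoot z := by
  classical
  refine (eigenvalue_signedMatrix hg hgN hW hz hv0).resolve_left fun hz0 => hv0 ?_
  obtain ⟨⟨σ, hσ⟩, hinj⟩ := hreg
  rw [hz0, zero_smul] at hz
  have hv : IsCycle τ.branch v := fun h => by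
    set G : ℂ → ℂ := fun x => N.retr (g x) with hG
    have h1 := coboundary_mulVec (G := G) hW v (h ∘ Function.invFunOn G (switches τ.branch))
    have hinv : ∀ x ∈ switches τ.branch, Function.invFunOn G (switches τ.branch) (G x) = x :=
      fun x hx => hinj.leftInvOn_invFunOn hx
    rw [hz] at h1
    simp only [coboundary, Function.comp_apply, hinv _ (Or.inl (mem_range_self _)),
      hinv _ (Or.inr (mem_range_self _)), Pi.zero_apply, zero_mul, Finset.sum_const_zero] at h1
    exact h1.symm
  ext j
  by_cases hj : IsInfinitesimal τ j
  swap
  · exact hv.apply_eq_zero hj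
  have hsing : ∀ k : {i // IsInfinitesimal τ i}, ∃ s, W k = [((σ k : ι), s)] := fun k => by
    obtain ⟨s, hs⟩ := hσ k
    exact (hW k).eq_singleton hs
  have h2 := congrFun hz (σ ⟨j, hj⟩ : ι)
  rw [Matrix.mulVec, dotProduct, Finset.sum_eq_single j] at h2
  · obtain ⟨s, hs⟩ := hsing ⟨j, hj⟩
    rw [signedMatrix_apply_eq_sum, hs] at h2
    cases s <;> simpa [letterSign] using h2
  · intro k _ hkj
    by_cases hk : IsInfinitesimal τ k
    · obtain ⟨s, hs⟩ := hsing ⟨k, hk⟩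
      rw [signedMatrix_apply_eq_sum, hs]
      have : ¬ (σ ⟨k, hk⟩ : ι) = σ ⟨j, hj⟩ := fun h =>
        hkj (congrArg Subtype.val (σ.injective (Subtype.ext h)))
      simp [this]
    · rw [hv.apply_eq_zero hk, mul_zero]
  · simp

end Eigenvalues

/-! ### Connectedness of a train track -/

theorem exists_exp_eq_of_norm_eq_one {z : ℂ} (hz : ‖z‖ = 1) :
    ∃ t ∈ Icc (0 : ℝ) 1, Complex.exp (2 * Real.pi * t * Complex.I) = z := by
  refine ⟨Int.fract (z.arg / (2 * Real.pi)), ⟨Int.fract_nonneg _, (Int.fract_lt_one _).le⟩, ?_⟩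
  have h1 : Complex.exp (z.arg * Complex.I) = z := by
    have := Complex.norm_mul_exp_arg_mul_I z
    rwa [hz, Complex.ofReal_one, one_mul] at this
  have hpi : (Real.pi : ℂ) ≠ 0 := by exact_mod_cast Real.pi_ne_zero
  refine Eq.trans ?_ h1
  rw [Complex.exp_eq_exp_iff_exists_int]
  refine ⟨-⌊z.arg / (2 * Real.pi)⌋, ?_⟩
  rw [← Int.self_sub_floor]
  push_cast
  field_simp
  ring

section Connected

variable {ι : Type*} [Fintype ι] {n : ℕ} {D : PuncturedDisk n} (τ : TrainTrack D ι)

theorem TrainTrack.support_subset_closedBall : support τ.branch ⊆ closedBall 0 1 := fun _ hx =>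
  mem_closedBall_zero_iff.2 (τ.norm_lt_one hx).le

/-- The part of the track in the closure of a complementary region is contained in a connected
subset of the track, namely the closed edge path bounding the region. -/
theorem TrainTrack.exists_isPreconnected_of_face {x : ℂ}
    (hx : x ∈ closedBall (0 : ℂ) 1 \ support τ.branch) :
    ∃ K, IsPreconnected K ∧ K ⊆ support τ.branch ∧
      closure (face τ.branch x) ∩ support τ.branch ⊆ K := by
  obtain ⟨Φ, A, hA, hsub, hΦ, hcirc, ⟨w, hw⟩, hin⟩ : ∃ (Φ : ℂ → ℂ) (A : Set ℂ), IsCompact A ∧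
      face τ.branch x ⊆ Φ '' A ∧ ContinuousOn Φ A ∧ (∀ z, ‖z‖ = 1 → z ∈ A) ∧
      (∃ w, TracesWord τ.branch (fun t => Φ (Complex.exp (2 * Real.pi * t * Complex.I))) 0 w 1) ∧
      ∀ z ∈ A, ‖z‖ ≠ 1 → Φ z ∈ face τ.branch x := by
    by_cases hd : Disjoint (face τ.branch x) (sphere 0 1)
    · obtain ⟨k, ⟨Φ, hΦ, -, himg, w, -, hw⟩, -⟩ := τ.interior_face x hx hd
      refine ⟨Φ, closedBall 0 1, isCompact_closedBall 0 1, ?_, hΦ, fun z hz => by simp [hz],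
        ⟨w, hw⟩, fun z hz hz1 => ?_⟩
      · rw [← himg]; exact image_mono ball_subset_closedBall
      · rw [← himg]
        exact mem_image_of_mem _ (mem_ball_zero_iff.2
          (lt_of_le_of_ne (mem_closedBall_zero_iff.1 hz) hz1))
    · obtain ⟨k, ⟨Φ, hΦ, -, himg, -, w, -, hw⟩, -⟩ := τ.exterior_face x hx hd
      have hc : IsCompact {z : ℂ | 1 ≤ ‖z‖ ∧ ‖z‖ ≤ 2} := by
        refine (isCompact_closedBall (0 : ℂ) 2).of_isClosed_subset ?_ fun z hz =>
          mem_closedBall_zero_iff.2 hz.2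
        exact (isClosed_le continuous_const continuous_norm).inter
          (isClosed_le continuous_norm continuous_const)
      refine ⟨Φ, _, hc, ?_, hΦ, fun z hz => by norm_num [hz], ⟨w, hw⟩, fun z hz hz1 => ?_⟩
      · rw [← himg]; exact image_mono fun z hz => ⟨hz.1.le, hz.2⟩
      · rw [← himg]
        exact mem_image_of_mem _ ⟨lt_of_le_of_ne hz.1 (Ne.symm hz1), hz.2⟩
  refine ⟨(fun t : ℝ => Φ (Complex.exp (2 * Real.pi * t * Complex.I))) '' Icc 0 1,
    isPreconnected_Icc.image _ (hΦ.comp (by fun_prop) fun t _ => hcirc _ ?_),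
    image_subset_iff.2 fun t ht => hw.mem_support zero_lt_one t ht, ?_⟩
  · rw [Complex.norm_exp]; simp
  · rintro y ⟨hy, hyS⟩
    obtain ⟨z, hz, rfl⟩ := closure_minimal hsub (hA.image_of_continuousOn hΦ).isClosed hy
    have hz1 : ‖z‖ = 1 := by
      by_contra h
      exact (face_subset _ _ (hin z hz h)).2 hyS
    obtain ⟨t, ht, rfl⟩ := exists_exp_eq_of_norm_eq_one hz1
    exact ⟨t, ht, rfl⟩

theorem TrainTrack.exists_mem_segment {x y : ℂ} (hx : x ∈ closedBall (0 : ℂ) 1 \ support τ.branch)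
    (hy : y ∈ support τ.branch) :
    ∃ z ∈ segment ℝ x y, z ∈ closure (face τ.branch x) ∩ support τ.branch := by
  set f : ℝ → ℂ := fun s => AffineMap.lineMap (k := ℝ) x y s with hf
  have hfc : Continuous f := AffineMap.lineMap_continuous
  have hseg : ∀ t ∈ Icc (0 : ℝ) 1, f t ∈ segment ℝ x y := fun t ht => by
    rw [segment_eq_image_lineMap]; exact ⟨t, ht, rfl⟩
  obtain ⟨t, ⟨ht, htS⟩, hmin⟩ := (isCompact_Icc.inter_right
    (τ.isCompact_support.isClosed.preimage hfc)).exists_isLeast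
      ⟨(1 : ℝ), right_mem_Icc.2 zero_le_one, by simpa [hf] using hy⟩
  have ht0 : 0 < t := ht.1.lt_of_ne fun h => hx.2 (by
    have : f t ∈ support τ.branch := htS
    simpa [← h, hf] using this)
  refine ⟨f t, hseg t ht, ?_, htS⟩
  have hsub : f '' Ico 0 t ⊆ face τ.branch x := by
    refine (isPreconnected_Ico.image _ hfc.continuousOn).subset_connectedComponentIn
      ⟨0, ⟨le_rfl, ht0⟩, by simp [hf]⟩ (image_subset_iff.2 fun s hs => ⟨?_, fun h => ?_⟩)
    · exact (convex_closedBall (0 : ℂ) 1).segment_subset hx.1 (τ.support_subset_closedBall hy)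
        (hseg s ⟨hs.1, hs.2.le.trans ht.2⟩)
    · exact hs.2.not_ge (hmin ⟨⟨hs.1, hs.2.le.trans ht.2⟩, h⟩)
  refine closure_mono hsub (image_closure_subset_closure_image hfc ⟨t, ?_, rfl⟩)
  rw [closure_Ico ht0.ne]
  exact ⟨ht0.le, le_rfl⟩

/-- The track is connected.  A separation of it would extend to a separation of the disk, each
complementary region being assigned to the part of the track that contains its boundary path. -/
theorem TrainTrack.isPreconnected_support : IsPreconnected (support τ.branch) := by
  rw [isPreconnected_closed_iff]
  rintro A B hA hB hAB ⟨a, haS, haA⟩ ⟨b, hbS, hbB⟩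
  by_contra hne
  have hdisj : ∀ x ∈ support τ.branch, x ∈ A → x ∉ B := fun x hx h1 h2 => hne ⟨x, hx, h1, h2⟩
  have hface : ∀ x ∈ closedBall (0 : ℂ) 1 \ support τ.branch,
      (closure (face τ.branch x) ∩ support τ.branch ∩ A).Nonempty →
      (closure (face τ.branch x) ∩ support τ.branch ∩ B).Nonempty → False := by
    rintro x hx ⟨y, hy, hyA⟩ ⟨z, hz, hzB⟩
    obtain ⟨K, hK, hKS, hKx⟩ := τ.exists_isPreconnected_of_face hx
    obtain ⟨w, hw, hwA, hwB⟩ := isPreconnected_closed_iff.1 hK A B hA hB (hKS.trans hAB)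
      ⟨y, hKx hy, hyA⟩ ⟨z, hKx hz, hzB⟩
    exact hdisj w (hKS hw) hwA hwB
  have hsegball : ∀ {x y z : ℂ} {r : ℝ}, y ∈ ball x r → z ∈ segment ℝ y x → z ∈ ball x r :=
    fun {x y z r} hy hz => (convex_ball x r).segment_subset hy
      (mem_ball_self (pos_of_mem_ball hy)) hz
  set P : ℂ → Prop := fun x => (x ∈ support τ.branch ∧ x ∈ A) ∨
    (x ∉ support τ.branch ∧ (closure (face τ.branch x) ∩ support τ.branch ∩ A).Nonempty) with hP
  have hconst : P a = P b := by
    refine (convex_closedBall (0 : ℂ) 1).isPreconnected.eq_of_eventually_eq (fun x hx => ?_)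
      (τ.support_subset_closedBall haS) (τ.support_subset_closedBall hbS)
    by_cases hxS : x ∈ support τ.branch
    · rcases hAB hxS with hxA | hxB
      · obtain ⟨r, hr, hrB⟩ := Metric.isOpen_iff.1 hB.isOpen_compl x (hdisj x hxS hxA)
        filter_upwards [self_mem_nhdsWithin, mem_nhdsWithin_of_mem_nhds (ball_mem_nhds x hr)]
          with y hy hyr
        have hPx : P x := Or.inl ⟨hxS, hxA⟩
        have hPy : P y := by
          by_cases hyS : y ∈ support τ.branch
          · exact Or.inl ⟨hyS, (hAB hyS).resolve_right (hrB hyr)⟩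
          · obtain ⟨z, hz, hz'⟩ := τ.exists_mem_segment ⟨hy, hyS⟩ hxS
            exact Or.inr ⟨hyS, z, hz', (hAB hz'.2).resolve_right (hrB (hsegball hyr hz))⟩
        exact propext (iff_of_true hPy hPx)
      · have hxA : x ∉ A := fun h => hdisj x hxS h hxB
        obtain ⟨r, hr, hrA⟩ := Metric.isOpen_iff.1 hA.isOpen_compl x hxA
        filter_upwards [self_mem_nhdsWithin, mem_nhdsWithin_of_mem_nhds (ball_mem_nhds x hr)]
          with y hy hyr
        have hPx : ¬ P x := by
          rintro (h | h)
          · exact hxA h.2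
          · exact h.1 hxS
        have hPy : ¬ P y := by
          rintro (h | ⟨hyS, h⟩)
          · exact hrA hyr h.2
          · obtain ⟨z, hz, hz'⟩ := τ.exists_mem_segment ⟨hy, hyS⟩ hxS
            exact hface y ⟨hy, hyS⟩ h
              ⟨z, hz', (hAB hz'.2).resolve_left (hrA (hsegball hyr hz))⟩
        exact propext (iff_of_false hPy hPx)
    · obtain ⟨r, hr, hrS⟩ := Metric.isOpen_iff.1 τ.isCompact_support.isClosed.isOpen_compl x hxS
      filter_upwards [self_mem_nhdsWithin, mem_nhdsWithin_of_mem_nhds (ball_mem_nhds x hr)]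
        with y hy hyr
      have hyS : y ∉ support τ.branch := hrS hyr
      have hpre : IsPreconnected (ball x r ∩ closedBall 0 1) :=
        ((convex_ball x r).inter (convex_closedBall (0 : ℂ) 1)).isPreconnected
      have hmem : y ∈ face τ.branch x := hpre.subset_connectedComponentIn
        (F := closedBall 0 1 \ support τ.branch) ⟨mem_ball_self hr, hx⟩
        (fun z hz => ⟨hz.2, hrS hz.1⟩) ⟨hyr, hy⟩
      have hfeq : face τ.branch x = face τ.branch y := connectedComponentIn_eq hmem
      simp [hP, hxS, hyS, hfeq]
  have hPa : P a := Or.inl ⟨haS, haA⟩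
  rw [hconst] at hPa
  rcases hPa with h | h
  · exact hdisj b hbS h.2 hbB
  · exact h.1 hbS

variable {τ} in
/-- A function on the branches which agrees on branches ending at a common switch is constant. -/
theorem TrainTrack.eq_of_endPt_eq {E : ι → Bool}
    (hE : ∀ a b : ι × Bool, endPt τ.branch a = endPt τ.branch b → E a.1 = E b.1) (i j : ι) :
    E i = E j := by
  by_contra hij
  wlog hi : E i = true generalizing i j
  · exact this j i (Ne.symm hij) (by
      cases h : E j
      · exact (hij ((Bool.eq_false_of_not_eq_true hi).trans h.symm)).elim
      · rfl)
  have hj : E j = false := Bool.eq_false_of_not_eq_true fun h => hij (hi.trans h.symm)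
  set S : Bool → Set ℂ := fun b => ⋃ k ∈ {k | E k = b}, τ.branch k '' Icc 0 1 with hS
  have hclosed : ∀ b, IsClosed (S b) := fun b => (toFinite _).isClosed_biUnion fun k _ =>
    (isCompact_Icc.image (τ.continuous_branch k)).isClosed
  have h01 : (0 : ℝ) ∈ Icc (0 : ℝ) 1 := left_mem_Icc.2 zero_le_one
  have hmem : ∀ k, ∀ t ∈ Icc (0 : ℝ) 1, τ.branch k t ∈ S (E k) := fun k t ht =>
    mem_iUnion₂.2 ⟨k, rfl, t, ht, rfl⟩
  obtain ⟨x, -, hx1, hx2⟩ := isPreconnected_closed_iff.1 τ.isPreconnected_support (S true) (S false)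
    (hclosed _) (hclosed _) (fun x hx => by
      obtain ⟨k, t, ht, rfl⟩ := mem_iUnion.1 hx
      cases hk : E k
      · exact Or.inr (hk ▸ hmem k t ht)
      · exact Or.inl (hk ▸ hmem k t ht))
    ⟨_, τ.mem_support h01, hi ▸ hmem i 0 h01⟩ ⟨_, τ.mem_support h01, hj ▸ hmem j 0 h01⟩
  obtain ⟨k, hk, s, hs, rfl⟩ := mem_iUnion₂.1 hx1
  obtain ⟨l, hl, t, ht, hkl⟩ := mem_iUnion₂.1 hx2
  have hne : k ≠ l := fun h => by
    rw [mem_ofPred_eq] at hk hl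
    rw [h, hl] at hk
    exact Bool.false_ne_true hk
  have hend : ∀ (k : ι) (s : ℝ), s ∈ Icc (0 : ℝ) 1 → s ∉ Ioo (0 : ℝ) 1 →
      ∃ b, endPt τ.branch (k, b) = τ.branch k s := fun k s hs hs' => by
    rcases hs.1.eq_or_lt with rfl | h0
    · exact ⟨false, rfl⟩
    · rcases hs.2.eq_or_lt with rfl | h1
      · exact ⟨true, rfl⟩
      · exact (hs' ⟨h0, h1⟩).elim
  obtain ⟨b, hb⟩ := hend k s hs fun h => hne (τ.embedded k l s h t ht hkl.symm).1
  obtain ⟨b', hb'⟩ := hend l t ht fun h => hne (τ.embedded l k t h s hs hkl).1.symm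
  have := hE (k, b) (l, b') (hb.trans (hkl.symm.trans hb'.symm))
  rw [mem_ofPred_eq] at hk hl
  simp only [hk, hl] at this
  exact Bool.false_ne_true this.symm

end Connected

/-! ### Orientation of lifted paths -/

section Lifts

variable {ι : Type*}

/-- The oriented arc run backwards. -/
def flip (x : ι × Bool) : ι × Bool := (x.1, !x.2)

/-- The parameter at which an oriented arc starts. -/
def startParam (s : Bool) : ℝ := if s then 0 else 1

theorem startParam_mem (s : Bool) : startParam s ∈ Icc (0 : ℝ) 1 := by
  cases s <;> simp [startParam]

/-- The sign of a letter as a real number. -/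
def letterSignReal (s : Bool) : ℝ := if s then 1 else -1

theorem letterSignReal_ne_zero (s : Bool) : letterSignReal s ≠ 0 := by
  cases s <;> simp [letterSignReal]

theorem startPt_eq (e : ι → ℝ → ℂ) (x : ι × Bool) : startPt e x = e x.1 (startParam x.2) := by
  obtain ⟨i, _ | _⟩ := x <;> simp [startPt, startParam]

theorem startDir_eq (e : ι → ℝ → ℂ) (x : ι × Bool) :
    startDir e x = letterSignReal x.2 • deriv (e x.1) (startParam x.2) := by
  obtain ⟨i, _ | _⟩ := x <;> simp [startDir, startParam, letterSignReal]

theorem endPt_eq (e : ι → ℝ → ℂ) (x : ι × Bool) : endPt e x = startPt e (flip x) := by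
  obtain ⟨i, _ | _⟩ := x <;> rfl

theorem endDir_eq (e : ι → ℝ → ℂ) (x : ι × Bool) : endDir e x = -startDir e (flip x) := by
  obtain ⟨i, _ | _⟩ := x <;> simp [endDir, startDir, flip]

theorem flip_flip (x : ι × Bool) : flip (flip x) = x := by simp [flip]

theorem orientedImage_flip (W : ι → List (ι × Bool)) (a : ι × Bool) :
    orientedImage W (flip a) = ((orientedImage W a).map flip).reverse := by
  have h : (flip : ι × Bool → ι × Bool) ∘ flip = id := funext flip_flip
  obtain ⟨i, _ | _⟩ := a
  · change W i = (List.map flip (List.map flip (W i)).reverse).reverse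
    rw [List.map_reverse, List.reverse_reverse, List.map_map, h, List.map_id]
  · rfl

theorem orientedImage_head_flip (W : ι → List (ι × Bool)) (a l : ι × Bool) :
    l ∈ (orientedImage W (flip a)).head? ↔ flip l ∈ (orientedImage W a).getLast? := by
  have hinj : ∀ x y : ι × Bool, flip x = y ↔ x = flip y := fun x y =>
    ⟨fun h => by rw [← h, flip_flip], fun h => by rw [h, flip_flip]⟩
  rw [orientedImage_flip, List.head?_reverse, List.getLast?_map]
  cases (orientedImage W a).getLast? <;> simp [hinj]

variable [Fintype ι] {n : ℕ} {D : PuncturedDisk n} {τ : TrainTrack D ι}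

theorem TrainTrack.startDir_ne_zero (x : ι × Bool) : startDir τ.branch x ≠ 0 := by
  rw [startDir_eq]
  exact smul_ne_zero (letterSignReal_ne_zero _) (τ.deriv_ne_zero _ _ (startParam_mem _))

theorem TrainTrack.endDir_ne_zero (x : ι × Bool) : endDir τ.branch x ≠ 0 := by
  rw [endDir_eq, neg_ne_zero]; exact τ.startDir_ne_zero _

theorem TrainTrack.exists_smul_deriv {i j : ι} {s t : ℝ} (hs : s ∈ Icc (0 : ℝ) 1)
    (ht : t ∈ Icc (0 : ℝ) 1) (h : τ.branch i s = τ.branch j t) :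
    ∃ r : ℝ, deriv (τ.branch j) t = r • deriv (τ.branch i) s := by
  by_cases hs' : s ∈ Ioo (0 : ℝ) 1
  · obtain ⟨rfl, rfl⟩ := τ.embedded i j s hs' t ht h
    exact ⟨1, (one_smul _ _).symm⟩
  by_cases ht' : t ∈ Ioo (0 : ℝ) 1
  · obtain ⟨rfl, rfl⟩ := τ.embedded j i t ht' s hs h.symm
    exact ⟨1, (one_smul _ _).symm⟩
  have hend : ∀ (k : ι) (s : ℝ), s ∈ Icc (0 : ℝ) 1 → s ∉ Ioo (0 : ℝ) 1 →
      ∃ b, endPt τ.branch (k, b) = τ.branch k s ∧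
        (endDir τ.branch (k, b) = deriv (τ.branch k) s ∨
          endDir τ.branch (k, b) = -deriv (τ.branch k) s) := fun k s hs hs' => by
    rcases hs.1.eq_or_lt with rfl | h0
    · exact ⟨false, rfl, Or.inr rfl⟩
    · rcases hs.2.eq_or_lt with rfl | h1
      · exact ⟨true, rfl, Or.inl rfl⟩
      · exact (hs' ⟨h0, h1⟩).elim
  obtain ⟨b, hb, hb1⟩ := hend i s hs hs'
  obtain ⟨b', hb', hb1'⟩ := hend j t ht ht'
  have key : ∃ r : ℝ, endDir τ.branch (j, b') = r • endDir τ.branch (i, b) := by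
    rcases τ.tangent_line (i, b) (j, b') (hb.trans (h.trans hb'.symm)) with h | h
    · obtain ⟨r, -, hr⟩ := h.exists_nonneg_left (τ.endDir_ne_zero _)
      exact ⟨r, hr.symm⟩
    · obtain ⟨r, -, hr⟩ := h.exists_nonneg_left (τ.endDir_ne_zero _)
      exact ⟨-r, by rw [neg_smul, hr, neg_neg]⟩
  obtain ⟨r, hr⟩ := key
  rcases hb1 with h1 | h1 <;> rcases hb1' with h2 | h2 <;> rw [h1, h2] at hr
  · exact ⟨r, hr⟩
  · exact ⟨-r, by rw [neg_smul, ← hr, neg_neg]⟩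
  · exact ⟨-r, by rw [neg_smul, ← smul_neg, hr]⟩
  · exact ⟨r, by rw [← neg_inj, hr, smul_neg]⟩

variable {M : Type*} [TopologicalSpace M] (c : OrientationDoubleCover τ M)

namespace OrientationDoubleCover

/-- The component of the vector `w` along the orientation at the point `y` of the lifted track; it
is positive if `w` agrees with the orientation. -/
def along (y : M) (w : ℂ) : ℝ := (c.dir y * (starRingEnd ℂ) w).re

theorem along_smul (y : M) (r : ℝ) (w : ℂ) : c.along y (r • w) = r * c.along y w := by
  simp [along]; ring

theorem along_neg (y : M) (w : ℂ) : c.along y (-w) = -c.along y w := by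
  simp [along]

theorem along_deck {y : M} (hy : (c.proj y : ℂ) ∈ support τ.branch) (w : ℂ) :
    c.along (c.deck y) w = -c.along y w := by
  simp [along, c.dir_deck y hy]

variable {c}

theorem along_deriv_ne_zero {y : M} {i : ι} {t : ℝ} (ht : t ∈ Icc (0 : ℝ) 1)
    (hy : (c.proj y : ℂ) = τ.branch i t) : c.along y (deriv (τ.branch i) t) ≠ 0 := by
  obtain ⟨h1, j, s, hs, hjs, r, hr⟩ := c.dir_tangent y (hy ▸ τ.mem_support ht)
  obtain ⟨r', hr'⟩ := τ.exists_smul_deriv ht hs (hy.symm.trans hjs.symm)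
  rw [hr', smul_smul] at hr
  have hrr : r * r' ≠ 0 := fun h => by simp [hr, h] at h1
  have h0 := τ.deriv_ne_zero i t ht
  rw [along, hr, Complex.real_smul, mul_assoc, Complex.mul_conj, ← Complex.ofReal_mul,
    Complex.ofReal_re]
  exact mul_ne_zero hrr (by simpa using h0)

theorem along_startDir_ne_zero {y : M} {x : ι × Bool} (hy : (c.proj y : ℂ) = startPt τ.branch x) :
    c.along y (startDir τ.branch x) ≠ 0 := by
  rw [startDir_eq, along_smul]
  exact mul_ne_zero (letterSignReal_ne_zero _)
    (along_deriv_ne_zero (startParam_mem _) (hy.trans (startPt_eq _ _)))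

theorem along_pos_iff_of_sameRay {v w : ℂ} (h : SameRay ℝ v w) (hv : v ≠ 0) (hw : w ≠ 0) (y : M) :
    0 < c.along y v ↔ 0 < c.along y w := by
  obtain ⟨r, hr, rfl⟩ := h.exists_pos_left hv hw
  rw [along_smul, mul_pos_iff_of_pos_left hr]

theorem along_neg_pos_iff {y : M} {w : ℂ} (h : c.along y w ≠ 0) :
    0 < c.along y (-w) ↔ ¬ 0 < c.along y w := by
  rw [along_neg, neg_pos, not_lt]
  exact ⟨le_of_lt, fun h' => lt_of_le_of_ne h' h⟩

theorem along_deck_pos_iff {y : M} (hy : (c.proj y : ℂ) ∈ support τ.branch) {w : ℂ}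
    (h : c.along y w ≠ 0) : 0 < c.along (c.deck y) w ↔ ¬ 0 < c.along y w := by
  rw [along_deck c hy, ← along_neg, along_neg_pos_iff h]

theorem eq_deck_of_proj_eq {y z : M} (h : (c.proj y : ℂ) = c.proj z) (hne : z ≠ y) : z = c.deck y :=
  ((c.proj_eq_iff y z).1 (Subtype.ext h)).resolve_left hne

theorem coe_proj_deck (y : M) : (c.proj (c.deck y) : ℂ) = c.proj y :=
  congrArg Subtype.val ((c.proj_eq_iff _ _).2 (Or.inr rfl)).symm

/-- A point over the track is determined by its projection and by the orientation there. -/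
theorem eq_of_along {y z : M} {i : ι} {t : ℝ} (ht : t ∈ Icc (0 : ℝ) 1)
    (hy : (c.proj y : ℂ) = τ.branch i t) (hz : (c.proj z : ℂ) = τ.branch i t)
    (h : 0 < c.along y (deriv (τ.branch i) t) ↔ 0 < c.along z (deriv (τ.branch i) t)) : z = y := by
  by_contra hne
  rw [eq_deck_of_proj_eq (hy.trans hz.symm) hne,
    along_deck_pos_iff (hy ▸ τ.mem_support ht) (along_deriv_ne_zero ht hy)] at h
  exact iff_not_self h

theorem along_pos_iff_of_path {S : Set ℝ} (hS : IsPreconnected S) {f : ℝ → M} {θ : ℝ → ℝ} {i : ι}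
    (hf : ContinuousOn f S) (hθ : ContinuousOn θ S) (hθ1 : ∀ t ∈ S, θ t ∈ Icc (0 : ℝ) 1)
    (hp : ∀ t ∈ S, (c.proj (f t) : ℂ) = τ.branch i (θ t)) {s t : ℝ} (hs : s ∈ S) (ht : t ∈ S) :
    0 < c.along (f s) (deriv (τ.branch i) (θ s)) ↔
      0 < c.along (f t) (deriv (τ.branch i) (θ t)) := by
  refine hS.pos_iff_pos (f := fun t => c.along (f t) (deriv (τ.branch i) (θ t))) ?_
    (fun t ht => along_deriv_ne_zero (hθ1 t ht) (hp t ht)) hs ht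
  have h1 : ContinuousOn (fun t => c.dir (f t)) S := c.dir_continuousOn.comp hf fun t ht => by
    rw [mem_ofPred_eq, hp t ht]; exact τ.mem_support (hθ1 t ht)
  have h2 : ContinuousOn (fun t => deriv (τ.branch i) (θ t)) S :=
    ((τ.contDiff i).continuous_deriv le_rfl).comp_continuousOn hθ
  exact Complex.continuous_re.comp_continuousOn
    (h1.mul (Complex.continuous_conj.comp_continuousOn h2))

end OrientationDoubleCover

open OrientationDoubleCover

variable {c} {γ : ℝ → ℂ} {f : ℝ → M}

/-- Along one letter of an edge path a lift keeps its direction relative to the orientation. -/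
theorem Traverses.along_iff {x : ι × Bool} {p q : ℝ}
    (h : Traverses γ (τ.branch x.1) x.2 p q) (hf : ContinuousOn f (Icc 0 1))
    (hp : ∀ t ∈ Icc (0 : ℝ) 1, (c.proj (f t) : ℂ) = γ t) :
    0 < c.along (f p) (startDir τ.branch x) ↔ 0 < c.along (f q) (endDir τ.branch x) := by
  obtain ⟨ha, hab, hb, -⟩ := id h
  obtain ⟨θ, hθc, hθ, -, heq, h0, h1⟩ := h.exists_param
  have hsub : Icc p q ⊆ Icc (0 : ℝ) 1 := Icc_subset_Icc ha hb
  have hl := left_mem_Icc.2 hab.le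
  have hr := right_mem_Icc.2 hab.le
  have hpr : ∀ t ∈ Icc p q, (c.proj (f t) : ℂ) = τ.branch x.1 (θ t) := fun t ht =>
    (hp t (hsub ht)).trans (heq t ht)
  have key := along_pos_iff_of_path isPreconnected_Icc (hf.mono hsub) hθc hθ hpr hl hr
  have hnl := along_deriv_ne_zero (hθ p hl) (hpr p hl)
  have hnr := along_deriv_ne_zero (hθ q hr) (hpr q hr)
  obtain ⟨i, _ | _⟩ := x
  · simp only [Bool.false_eq_true, if_false] at h0 h1
    rw [h0] at hnl
    rw [h1] at hnr
    rw [h0, h1] at key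
    simp only [startDir, endDir]
    rw [along_neg_pos_iff hnl, along_neg_pos_iff hnr, key]
  · simp only [if_true] at h0 h1
    rwa [h0, h1] at key

theorem TracesWord.along_iff {w : List (ι × Bool)} (hf : ContinuousOn f (Icc 0 1))
    (hp : ∀ t ∈ Icc (0 : ℝ) 1, (c.proj (f t) : ℂ) = γ t) {η : Prop} :
    ∀ {a b : ℝ}, TracesWord τ.branch γ a w b → w.IsChain (SmoothTurn τ.branch) →
      (∀ x ∈ w.head?, 0 < c.along (f a) (startDir τ.branch x) ↔ η) →
      ∀ y ∈ w.getLast?, 0 < c.along (f b) (endDir τ.branch y) ↔ η := by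
  induction w with
  | nil => simp
  | cons x w ih =>
    rintro a b ⟨d, h1, h2⟩ hch hhead y hy
    have h3 := (h1.along_iff hf hp).symm.trans (hhead x rfl)
    cases w with
    | nil =>
      rw [← show d = b from h2]
      obtain rfl : x = y := by simpa using hy
      exact h3
    | cons z w =>
      rw [List.isChain_cons_cons] at hch
      refine ih h2 hch.2 (fun x' hx' => ?_) y (by simpa [List.getLast?_cons_cons] using hy)
      obtain rfl : z = x' := by simpa using hx'
      rw [← along_pos_iff_of_sameRay hch.1.2 (τ.endDir_ne_zero _) (τ.startDir_ne_zero _)]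
      exact h3

/-- The intervals counted by a predicate which only holds on traversals, along an edge path, are
among those of the letters of its word. -/
theorem TracesWord.ncard_eq_countP {Q : ℝ → ℝ → Prop} {St : ℝ → ι × Bool → Prop}
    {P : ι × Bool → Prop} [DecidablePred P]
    (hQ : ∀ p q, Q p q → ∃ i s, Traverses γ (τ.branch i) s p q)
    (hP : ∀ x p q, Traverses γ (τ.branch x.1) x.2 p q → St p x → (Q p q ↔ P x))
    (hSt : ∀ x y p q, Traverses γ (τ.branch x.1) x.2 p q → St p x → SmoothTurn τ.branch x y →
      St q y) {w : List (ι × Bool)} :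
    ∀ {a b : ℝ}, TracesWord τ.branch γ a w b → w.IsChain (SmoothTurn τ.branch) →
      (∀ x ∈ w.head?, St a x) →
      {p : ℝ × ℝ | a ≤ p.1 ∧ p.2 ≤ b ∧ Q p.1 p.2}.Finite ∧
        {p : ℝ × ℝ | a ≤ p.1 ∧ p.2 ≤ b ∧ Q p.1 p.2}.ncard = w.countP (fun x => P x) := by
  induction w with
  | nil =>
    intro a b h _ _
    have : {p : ℝ × ℝ | a ≤ p.1 ∧ p.2 ≤ b ∧ Q p.1 p.2} = ∅ := by
      ext p
      simp only [mem_ofPred_eq, mem_empty_iff_false, iff_false]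
      rintro ⟨h1, h2, h3⟩
      obtain ⟨i, s, h4⟩ := hQ _ _ h3
      have h5 := h4.2.1
      rw [← show a = b from h] at h2
      linarith
    rw [this]
    simp
  | cons x w ih =>
    rintro a b ⟨d, h1, h2⟩ hch hhead
    have hx := hhead x rfl
    obtain ⟨hfin, hcard⟩ := ih h2 hch.tail fun y hy => by
      cases w with
      | nil => simp at hy
      | cons z w =>
        rw [List.isChain_cons_cons] at hch
        obtain rfl : z = y := by simpa using hy
        exact hSt x z a d h1 hx hch.1
    have hunion : {p : ℝ × ℝ | a ≤ p.1 ∧ p.2 ≤ b ∧ Q p.1 p.2} =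
        {p | p = (a, d) ∧ P x} ∪ {p : ℝ × ℝ | d ≤ p.1 ∧ p.2 ≤ b ∧ Q p.1 p.2} := by
      ext ⟨p, q⟩
      simp only [mem_ofPred_eq, mem_union, Prod.mk.injEq]
      constructor
      · rintro ⟨h3, h4, h5⟩
        obtain ⟨i, s, h6⟩ := hQ _ _ h5
        rcases h1.eq_or_le h6 h3 with ⟨rfl, rfl, -⟩ | h
        · exact Or.inl ⟨⟨rfl, rfl⟩, (hP x _ _ h1 hx).1 h5⟩
        · exact Or.inr ⟨h, h4, h5⟩
      · rintro (⟨⟨rfl, rfl⟩, h3⟩ | ⟨h3, h4, h5⟩)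
        · exact ⟨le_rfl, h2.le, (hP x _ _ h1 hx).2 h3⟩
        · exact ⟨h1.2.1.le.trans h3, h4, h5⟩
    have hfin1 : {p : ℝ × ℝ | p = (a, d) ∧ P x}.Finite :=
      (finite_singleton (a, d)).subset fun p hp => hp.1
    have hdisj : Disjoint {p : ℝ × ℝ | p = (a, d) ∧ P x}
        {p : ℝ × ℝ | d ≤ p.1 ∧ p.2 ≤ b ∧ Q p.1 p.2} := by
      rw [Set.disjoint_left]
      rintro _ ⟨rfl, -⟩ ⟨h3, -⟩
      exact h1.2.1.not_ge h3
    rw [hunion]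
    refine ⟨hfin1.union hfin, ?_⟩
    rw [ncard_union_eq hdisj hfin1 hfin, hcard, List.countP_cons, add_comm]
    congr 1
    by_cases hPx : P x <;> simp [hPx]

theorem TracesWord.occurrences_eq {w : List (ι × Bool)} (hw : TracesWord τ.branch γ 0 w 1)
    (hch : w.IsChain (SmoothTurn τ.branch)) (i : ι) [DecidablePred fun x : ι × Bool => x.1 = i] :
    occurrences γ (τ.branch i) = w.countP fun x => x.1 = i := by
  rw [← (TracesWord.ncard_eq_countP (Q := fun p q => ∃ s, Traverses γ (τ.branch i) s p q)
    (St := fun _ _ => True) (fun p q hQ => ⟨i, hQ⟩) (fun x p q h _ => ?_)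
    (fun _ _ _ _ _ _ _ => trivial) hw hch (fun _ _ => trivial)).2, Track.occurrences]
  · congr 1
    ext p
    simp only [mem_ofPred_eq]
    exact ⟨fun ⟨s, hs⟩ => ⟨hs.1, hs.2.2.1, s, hs⟩, fun h => h.2.2⟩
  · constructor
    · rintro ⟨s, hs⟩
      rcases h.eq_or_le hs le_rfl with ⟨-, -, h1⟩ | h1
      · exact h1.symm
      · exact (h.2.1.not_ge h1).elim
    · rintro rfl
      exact ⟨_, h⟩

variable {lift : ι × Bool → ℝ → M} (hlift : AreBranchLifts c lift)
include hlift

theorem AreBranchLifts.proj_eq {t : ℝ} (ht : t ∈ Icc (0 : ℝ) 1) (x : ι × Bool) :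
    (c.proj (lift x t) : ℂ) = τ.branch x.1 t := (hlift.1 x).2 t ht

/-- Whether a lifted branch is parametrized in the direction of the orientation. -/
def isPositive (c : OrientationDoubleCover τ M) (lift : ι × Bool → ℝ → M) (x : ι × Bool) : Prop :=
  0 < c.along (lift x 0) (deriv (τ.branch x.1) 0)

theorem AreBranchLifts.along_iff {t : ℝ} (ht : t ∈ Icc (0 : ℝ) 1) (x : ι × Bool) :
    0 < c.along (lift x t) (deriv (τ.branch x.1) t) ↔ isPositive c lift x :=
  along_pos_iff_of_path (θ := id) isPreconnected_Icc (hlift.1 x).1 continuousOn_id (fun _ h => h)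
    (fun _ h => hlift.proj_eq h x) ht (left_mem_Icc.2 zero_le_one)

theorem AreBranchLifts.isPositive_true_iff (i : ι) :
    isPositive c lift (i, true) ↔ ¬ isPositive c lift (i, false) := by
  have h0 : (0 : ℝ) ∈ Icc (0 : ℝ) 1 := left_mem_Icc.2 zero_le_one
  have hp := hlift.proj_eq h0 (i, false)
  rw [isPositive, isPositive, eq_deck_of_proj_eq (hp.trans (hlift.proj_eq h0 (i, true)).symm)
    (hlift.2 i).symm]
  exact along_deck_pos_iff (by rw [hp]; exact τ.mem_support h0) (along_deriv_ne_zero h0 hp)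

theorem AreBranchLifts.deck_lift (i : ι) (s : Bool) {t : ℝ} (ht : t ∈ Icc (0 : ℝ) 1) :
    c.deck (lift (i, s) t) = lift (i, !s) t := by
  have h1 : ∀ s, isPositive c lift (i, !s) ↔ ¬ isPositive c lift (i, s) := by
    rintro (_ | _)
    · exact hlift.isPositive_true_iff i
    · rw [Bool.not_true, hlift.isPositive_true_iff i, not_not]
  refine (eq_deck_of_proj_eq ((hlift.proj_eq ht _).trans (hlift.proj_eq ht (i, !s)).symm)
    (y := lift (i, s) t) fun h => ?_).symm
  have h2 := hlift.along_iff ht (i, !s)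
  rw [h, hlift.along_iff ht (i, s), h1 s] at h2
  exact iff_not_self h2

theorem AreBranchLifts.exists_eq {y : M} {i : ι} {t : ℝ} (ht : t ∈ Icc (0 : ℝ) 1)
    (hy : (c.proj y : ℂ) = τ.branch i t) : ∃ s, y = lift (i, s) t := by
  by_cases h : y = lift (i, false) t
  · exact ⟨false, h⟩
  · refine ⟨true, ?_⟩
    rw [eq_deck_of_proj_eq ((hlift.proj_eq ht _).trans hy.symm) h, hlift.deck_lift i false ht]
    rfl

/-- A lift of a path that traverses a branch traverses the lifted branch singled out by the
orientation. -/
theorem AreBranchLifts.traverses_iff {x : ι × Bool} {p q : ℝ}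
    (h : Traverses γ (τ.branch x.1) x.2 p q) (hf : ContinuousOn f (Icc 0 1))
    (hp : ∀ t ∈ Icc (0 : ℝ) 1, (c.proj (f t) : ℂ) = γ t) {η : Prop}
    (hη : 0 < c.along (f p) (startDir τ.branch x) ↔ η) (y : ι × Bool) :
    (∃ s, Traverses f (lift y) s p q) ↔
      x.1 = y.1 ∧ (x.2 = true ↔ (η ↔ isPositive c lift y)) := by
  obtain ⟨ha, hab, hb, θ, hθc, heq, hmono⟩ := id h
  obtain ⟨hθ, hθi, h0, -⟩ := traversal_param_spec hab hmono
  have hsub : Icc p q ⊆ Icc (0 : ℝ) 1 := Icc_subset_Icc ha hb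
  have hl := left_mem_Icc.2 hab.le
  have hpr : ∀ t ∈ Icc p q, (c.proj (f t) : ℂ) = τ.branch x.1 (θ t) := fun t ht =>
    (hp t (hsub ht)).trans (heq t ht)
  have hstart : 0 < c.along (f p) (deriv (τ.branch x.1) (θ p)) ↔ (x.2 = true ↔ η) := by
    have hne := along_deriv_ne_zero (hθ p hl) (hpr p hl)
    rw [← hη, startDir_eq, show startParam x.2 = θ p from h0.symm]
    cases x.2
    · rw [show letterSignReal false = -1 from rfl, neg_one_smul, along_neg_pos_iff hne]
      simp
    · rw [show letterSignReal true = 1 from rfl, one_smul]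
      simp
  have hall : ∀ t ∈ Icc p q,
      0 < c.along (f t) (deriv (τ.branch x.1) (θ t)) ↔ (x.2 = true ↔ η) := fun t ht =>
    (along_pos_iff_of_path isPreconnected_Icc (hf.mono hsub) hθc hθ hpr ht hl).trans hstart
  constructor
  · rintro ⟨s, hs⟩
    obtain ⟨θ', -, hθ', -, heq', -⟩ := hs.exists_param
    have hm : (p + q) / 2 ∈ Ioo p q := ⟨by linarith, by linarith⟩
    have hm' := Ioo_subset_Icc_self hm
    have h1 := hpr _ hm'
    rw [heq' _ hm', hlift.proj_eq (hθ' _ hm')] at h1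
    obtain ⟨h2, h3⟩ := τ.embedded x.1 y.1 _ (hθi _ hm) _ (hθ' _ hm') h1.symm
    refine ⟨h2, ?_⟩
    have h4 := hall _ hm'
    rw [heq' _ hm', h2, h3, hlift.along_iff (hθ' _ hm')] at h4
    tauto
  · rintro ⟨h1, h2⟩
    refine ⟨x.2, ha, hab, hb, θ, hθc, fun t ht => ?_, hmono⟩
    refine eq_of_along (hθ t ht) ((hlift.proj_eq (hθ t ht) y).trans (by rw [h1])) (hpr t ht) ?_
    have h3 := hlift.along_iff (hθ t ht) y
    rw [← h1] at h3
    rw [h3, hall t ht]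
    tauto

/-- The occurrences of a lifted branch in a lift of an edge path are the letters of its word of
one of the two signs, depending on the direction of the path. -/
theorem AreBranchLifts.occurrences_eq (hf : ContinuousOn f (Icc 0 1))
    (hp : ∀ t ∈ Icc (0 : ℝ) 1, (c.proj (f t) : ℂ) = γ t) {w : List (ι × Bool)}
    (hw : TracesWord τ.branch γ 0 w 1) (hch : w.IsChain (SmoothTurn τ.branch)) {η : Prop}
    (hη : ∀ x ∈ w.head?, 0 < c.along (f 0) (startDir τ.branch x) ↔ η) (y : ι × Bool)
    [DecidablePred fun x : ι × Bool => x.1 = y.1 ∧ (x.2 = true ↔ (η ↔ isPositive c lift y))] :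
    occurrences f (lift y) =
      w.countP fun x => x.1 = y.1 ∧ (x.2 = true ↔ (η ↔ isPositive c lift y)) := by
  rw [← (TracesWord.ncard_eq_countP (Q := fun p q => ∃ s, Traverses f (lift y) s p q)
    (St := fun p x => 0 < c.along (f p) (startDir τ.branch x) ↔ η) (fun p q hQ => ?_)
    (fun x p q h hx => hlift.traverses_iff h hf hp hx y) (fun x z p q h hx hxz => ?_)
    hw hch hη).2, occurrences]
  · congr 1
    ext p
    simp only [mem_ofPred_eq]
    exact ⟨fun ⟨s, hs⟩ => ⟨hs.1, hs.2.2.1, s, hs⟩, fun h => h.2.2⟩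
  · obtain ⟨s, hs⟩ := hQ
    obtain ⟨ha, hab, hb, θ, hθc, heq, hmono⟩ := id hs
    refine ⟨y.1, s, ha, hab, hb, θ, hθc, fun t ht => ?_, hmono⟩
    rw [← hp t (Icc_subset_Icc ha hb ht), heq t ht,
      hlift.proj_eq ((traversal_param_spec hab hmono).1 t ht)]
  · rw [← along_pos_iff_of_sameRay hxz.2 (τ.endDir_ne_zero _) (τ.startDir_ne_zero _),
      ← h.along_iff hf hp]
    exact hx

end Lifts

/-! ### The lifted map and the deck involution -/

section Equivariance

open OrientationDoubleCover

variable {ι : Type*} [Fintype ι] {n : ℕ} {D : PuncturedDisk n} {τ : TrainTrack D ι}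
  {N : FibredNhd τ} {M : Type*} [TopologicalSpace M] {c : OrientationDoubleCover τ M} {lr : M → M}

/-- The lifted retraction takes the initial point of a lift of a retraction path to its final
point: along such a path it only takes values in one fibre of the cover. -/
theorem IsLiftedRetraction.apply_eq_of_path (hlr : IsLiftedRetraction c N lr)
    {Γ : unitInterval → M} (hΓ : Continuous Γ) {x : ℂ}
    (hN : ∀ s, (c.proj (Γ s) : ℂ) ∈ N.carrier ∧ N.retr (c.proj (Γ s)) = x)
    (h1 : (c.proj (Γ 1) : ℂ) ∈ support τ.branch) : lr (Γ 0) = Γ 1 := by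
  have := c.t2
  have hc : Continuous fun s => lr (Γ s) :=
    hlr.1.comp_continuous hΓ fun s => (hN s).1
  have hfib : ∀ s t, lr (Γ t) = lr (Γ s) ∨ lr (Γ t) = c.deck (lr (Γ s)) := fun s t =>
    (c.proj_eq_iff _ _).1 (Subtype.ext (by
      rw [hlr.2.1 _ (hN s).1, hlr.2.1 _ (hN t).1, (hN s).2, (hN t).2]))
  rw [← hlr.2.2 _ h1]
  refine isPreconnected_univ.eq_of_eventually_eq (f := fun s => lr (Γ s)) (fun s _ => ?_)
    (mem_univ 0) (mem_univ 1)
  by_cases hs : c.deck (lr (Γ s)) = lr (Γ s)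
  · exact Filter.Eventually.of_forall fun t => (hfib s t).elim id fun h => h.trans hs
  · filter_upwards [(hc.continuousAt.eventually_ne (Ne.symm hs)).filter_mono inf_le_left] with t ht
    exact (hfib s t).resolve_right ht

theorem IsLiftedRetraction.apply_deck (hlr : IsLiftedRetraction c N lr)
    (hc : Disjoint c.branchPts N.carrier) {y : M} (hy : (c.proj y : ℂ) ∈ N.carrier) :
    lr (c.deck y) = c.deck (lr y) := by
  obtain ⟨H, hH, hH1, hH2, -⟩ := N.deformation
  have hmem : ∀ s : unitInterval, H (s, (c.proj y : ℂ)) ∈ N.carrier := fun s =>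
    (hH2 s s.2 _ hy).1
  have hHc : Continuous fun s : unitInterval => H (s, (c.proj y : ℂ)) :=
    hH.comp_continuous (by fun_prop) fun s => ⟨s.2, hy⟩
  let γ : C(unitInterval, {x : Disk | (x : ℂ) ∉ c.branchPts}) :=
    ⟨fun s => ⟨⟨H (s, (c.proj y : ℂ)), ball_subset_closedBall (N.subset_interior (hmem s)).1⟩,
      fun h => disjoint_left.1 hc h (hmem s)⟩, (hHc.subtype_mk _).subtype_mk _⟩
  obtain ⟨Γ, hΓ, hΓ0⟩ := c.isCoveringMapOn.isCoveringMap_restrictPreimage.exists_path_lifts γ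
    ⟨y, fun h => disjoint_left.1 hc h hy⟩
    (Subtype.ext (Subtype.ext (hH1 _ hy).1))
  have hproj : ∀ s, (c.proj (Γ s : M) : ℂ) = H (s, (c.proj y : ℂ)) := fun s =>
    congrArg (fun z : {x : Disk | (x : ℂ) ∉ c.branchPts} => (z : ℂ)) (congrFun hΓ s)
  have hΓc : Continuous fun s => (Γ s : M) := continuous_subtype_val.comp Γ.continuous
  have hN : ∀ s, (c.proj (Γ s : M) : ℂ) ∈ N.carrier ∧
      N.retr (c.proj (Γ s : M)) = N.retr (c.proj y) := fun s => by
    rw [hproj]; exact hH2 s s.2 _ hy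
  have h1 : (c.proj (Γ 1 : M) : ℂ) ∈ support τ.branch := by
    rw [hproj, Set.Icc.coe_one, (hH1 _ hy).2]
    exact N.retr_mapsTo hy
  have h0 : (Γ 0 : M) = y := congrArg Subtype.val hΓ0
  have key1 := hlr.apply_eq_of_path hΓc hN h1
  have key2 := hlr.apply_eq_of_path (c.deck.continuous.comp hΓc)
    (fun s => by rw [Function.comp_apply, coe_proj_deck]; exact hN s)
    (by rw [Function.comp_apply, coe_proj_deck]; exact h1)
  simp only [Function.comp_apply] at key2
  rw [h0] at key1 key2
  rw [key1, key2]

variable {g : ℂ → ℂ} {lf : M ≃ₜ M}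

theorem lift_apply_deck (hlf : ∀ y, (c.proj (lf y) : ℂ) = g (c.proj y)) {y : M}
    (hy : (c.proj y : ℂ) ∈ support τ.branch) : lf (c.deck y) = c.deck (lf y) := by
  refine eq_deck_of_proj_eq (by rw [hlf, hlf, coe_proj_deck]) fun h => ?_
  exact (c.branchPts_subset ((c.deck_eq_iff y).1 (lf.injective h))).2 hy

variable (hlr : IsLiftedRetraction c N lr) (hc : Disjoint c.branchPts N.carrier)
  (hgN : MapsTo g (support τ.branch) N.carrier)
  (hlf : ∀ y, (c.proj (lf y) : ℂ) = g (c.proj y))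

include hlr hgN hlf

theorem proj_liftedMap {y : M} (hy : (c.proj y : ℂ) ∈ support τ.branch) :
    (c.proj (lr (lf y)) : ℂ) = N.retr (g (c.proj y)) := by
  rw [hlr.2.1 _ (by rw [hlf]; exact hgN hy), hlf]

theorem proj_liftedMap_mem {y : M} (hy : (c.proj y : ℂ) ∈ support τ.branch) :
    (c.proj (lr (lf y)) : ℂ) ∈ support τ.branch := by
  rw [proj_liftedMap hlr hgN hlf hy]
  exact N.retr_mapsTo (hgN hy)

include hc in
theorem liftedMap_deck {y : M} (hy : (c.proj y : ℂ) ∈ support τ.branch) :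
    lr (lf (c.deck y)) = c.deck (lr (lf y)) := by
  rw [lift_apply_deck hlf hy, hlr.apply_deck hc (by rw [hlf]; exact hgN hy)]

variable {lift : ι × Bool → ℝ → M} (hlift : AreBranchLifts c lift) {W : ι → List (ι × Bool)}
  (hW : ∀ j, TracesWord τ.branch (fun t => N.retr (g (τ.branch j t))) 0 (W j) 1)
  (hch : ∀ j, (W j).IsChain (SmoothTurn τ.branch))
include hlift

theorem proj_liftedMap_lift (x : ι × Bool) {t : ℝ} (ht : t ∈ Icc (0 : ℝ) 1) :
    (c.proj (lr (lf (lift x t))) : ℂ) = N.retr (g (τ.branch x.1 t)) := by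
  have hp := hlift.proj_eq ht x
  rw [proj_liftedMap hlr hgN hlf (by rw [hp]; exact τ.mem_support ht), hp]

theorem continuousOn_liftedMap_lift (x : ι × Bool) :
    ContinuousOn (fun t => lr (lf (lift x t))) (Icc 0 1) :=
  hlr.1.comp (lf.continuous.comp_continuousOn (hlift.1 x).1) fun t ht => by
    rw [mem_ofPred_eq, hlf, hlift.proj_eq ht]
    exact hgN (τ.mem_support ht)

include hc hW hch in
/-- The lifted map preserves or reverses the orientation along each branch: the comparison at an
end of the branch depends neither on the end nor on the lift. -/
theorem exists_preserves : ∃ E : ι → Bool, ∀ (a : ι × Bool) (s : Bool),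
    ∀ l ∈ (orientedImage W a).head?,
      (0 < c.along (lr (lf (lift (a.1, s) (startParam a.2)))) (startDir τ.branch l) ↔
        0 < c.along (lift (a.1, s) (startParam a.2)) (startDir τ.branch a)) ↔ E a.1 = true := by
  classical
  have h01 : (0 : ℝ) ∈ Icc (0 : ℝ) 1 := left_mem_Icc.2 zero_le_one
  have h11 : (1 : ℝ) ∈ Icc (0 : ℝ) 1 := right_mem_Icc.2 zero_le_one
  refine ⟨fun i => decide (∀ l ∈ (W i).head?,
    (0 < c.along (lr (lf (lift (i, false) 0))) (startDir τ.branch l) ↔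
      0 < c.along (lift (i, false) 0) (deriv (τ.branch i) 0))), ?_⟩
  have hstart : ∀ (i : ι) (s : Bool), ∀ l ∈ (W i).head?,
      (0 < c.along (lr (lf (lift (i, s) 0))) (startDir τ.branch l) ↔
        isPositive c lift (i, s)) ↔ (∀ l ∈ (W i).head?,
    (0 < c.along (lr (lf (lift (i, false) 0))) (startDir τ.branch l) ↔
      0 < c.along (lift (i, false) 0) (deriv (τ.branch i) 0))) := by
    intro i s l hl
    have hfalse : (0 < c.along (lr (lf (lift (i, false) 0))) (startDir τ.branch l) ↔
        isPositive c lift (i, false)) ↔ (∀ l ∈ (W i).head?,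
        (0 < c.along (lr (lf (lift (i, false) 0))) (startDir τ.branch l) ↔
          0 < c.along (lift (i, false) 0) (deriv (τ.branch i) 0))) :=
      ⟨fun h l' hl' => by rwa [Option.mem_unique hl' hl], fun h => h l hl⟩
    -- passing to the other lift reverses both directions
    cases s
    · exact hfalse
    · rw [← hfalse, hlift.isPositive_true_iff i]
      have hp := hlift.proj_eq h01 (i, false)
      have hS : (c.proj (lift (i, false) 0) : ℂ) ∈ support τ.branch := by
        rw [hp]; exact τ.mem_support h01
      rw [show lift (i, true) 0 = c.deck (lift (i, false) 0) from
          (hlift.deck_lift i false h01).symm, liftedMap_deck hlr hc hgN hlf hS,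
        along_deck_pos_iff (proj_liftedMap_mem hlr hgN hlf hS)
          (along_startDir_ne_zero ((proj_liftedMap_lift hlr hgN hlf hlift (i, false) h01).trans
            ((hW i).startPt_head l hl)))]
      tauto
  rintro ⟨i, b⟩ s l hl
  rw [decide_eq_true_iff]
  cases b
  · obtain ⟨m, hm⟩ : ∃ m, m ∈ (W i).head? := by
      rcases hWi : W i with _ | ⟨m, w⟩
      · exact ((hW i).ne_nil hWi).elim
      · exact ⟨m, rfl⟩
    rw [← hstart i s m hm]
    have hl' := (orientedImage_head_flip W (i, true) l).1 hl
    -- both directions at the far end are the ones at the near end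
    have hend := (hW i).along_iff (f := fun t => lr (lf (lift (i, s) t)))
      (continuousOn_liftedMap_lift hlr hgN hlf hlift (i, s))
      (fun t ht => proj_liftedMap_lift hlr hgN hlf hlift (i, s) ht) (hch i)
      (η := 0 < c.along (lr (lf (lift (i, s) 0))) (startDir τ.branch m))
      (fun x hx => by rw [Option.mem_unique hx hm]) _ hl'
    have hpr := (proj_liftedMap_lift hlr hgN hlf hlift (i, s) h11).trans
      ((hW i).endPt_getLast _ hl')
    rw [endPt_eq, flip_flip] at hpr
    have hne := along_startDir_ne_zero hpr
    rw [endDir_eq, flip_flip, along_neg_pos_iff hne] at hend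
    have hsp : startParam false = 1 := rfl
    have hdir : startDir τ.branch (i, false) = -deriv (τ.branch i) 1 := rfl
    simp only [hsp, hdir]
    rw [← hend, along_neg_pos_iff (along_deriv_ne_zero h11 (hlift.proj_eq h11 _)),
      hlift.along_iff h11]
    tauto
  · exact hstart i s l hl

include hc hW hch in
/-- The lifted map preserves the orientation of the whole lifted track, or reverses it. -/
theorem exists_global_preserves
    (hturn : ∀ a b, SmoothTurn τ.branch a b → ∀ x ∈ (orientedImage W a).getLast?,
      ∀ y ∈ (orientedImage W b).head?, SmoothTurn τ.branch x y) :
    ∃ ε : Bool, ∀ x : ι × Bool, ∀ l ∈ (W x.1).head?,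
      (0 < c.along (lr (lf (lift x 0))) (startDir τ.branch l) ↔
        (isPositive c lift x ↔ ε = true)) := by
  obtain ⟨E, hE⟩ := exists_preserves hlr hc hgN hlf hlift hW hch
  have hnil : ∀ a, orientedImage W a ≠ [] := by
    rintro ⟨i, _ | _⟩ h
    · exact (hW i).ne_nil (by simpa [orientedImage] using h)
    · exact (hW i).ne_nil h
  have hsmooth : ∀ a b, SmoothTurn τ.branch a b → E a.1 = E b.1 := fun a b hab => by
    obtain ⟨x, hx⟩ : ∃ x, x ∈ (orientedImage W a).getLast? :=
      ⟨_, List.getLast?_eq_some_getLast (hnil a)⟩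
    obtain ⟨y, hy⟩ : ∃ y, y ∈ (orientedImage W b).head? := ⟨_, List.head?_eq_some_head (hnil b)⟩
    have hxy := hturn a b hab x hx y hy
    have hpt : τ.branch b.1 (startParam b.2) =
        τ.branch (flip a).1 (startParam (flip a).2) := by
      rw [← startPt_eq τ.branch b, ← startPt_eq τ.branch (flip a), ← hab.1, endPt_eq]
    have hb := hlift.proj_eq (startParam_mem b.2) (b.1, false)
    obtain ⟨s, hs⟩ := hlift.exists_eq (startParam_mem (flip a).2) (hb.trans hpt)
    have h1 := hE (flip a) s (flip x) ((orientedImage_head_flip W a _).2 (by rwa [flip_flip]))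
    have h2 := hE b false y hy
    rw [← hs] at h1
    set z := lift (b.1, false) (startParam b.2) with hz
    have hda : startDir τ.branch (flip a) = -endDir τ.branch a := by rw [endDir_eq, neg_neg]
    have hdx : startDir τ.branch (flip x) = -endDir τ.branch x := by rw [endDir_eq, neg_neg]
    have hzb : (c.proj z : ℂ) = startPt τ.branch b := hb.trans (startPt_eq _ _).symm
    have hsignb : ∀ {u v : ℂ} {m : M}, SameRay ℝ u v → u ≠ 0 → v ≠ 0 → c.along m v ≠ 0 →
        (0 < c.along m (-u) ↔ ¬ 0 < c.along m v) := fun {u v m} huv hu hv hne => by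
      rw [along_pos_iff_of_sameRay (v := -u) (w := -v) (by simpa using huv) (by simpa) (by simpa),
        along_neg_pos_iff hne]
    have hFz : (c.proj (lr (lf z)) : ℂ) = startPt τ.branch y := by
      rw [hz, proj_liftedMap_lift hlr hgN hlf hlift _ (startParam_mem b.2)]
      obtain ⟨i, _ | _⟩ := b
      · have hy' := (orientedImage_head_flip W (i, true) y).1 hy
        have := (hW i).endPt_getLast _ hy'
        rwa [endPt_eq, flip_flip] at this
      · exact (hW i).startPt_head y hy
    rw [hda, hdx, hsignb hab.2 (τ.endDir_ne_zero _) (τ.startDir_ne_zero _)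
        (along_startDir_ne_zero hzb),
      hsignb hxy.2 (τ.endDir_ne_zero _) (τ.startDir_ne_zero _) (along_startDir_ne_zero hFz)] at h1
    have h3 : E a.1 = true ↔ E b.1 = true := by
      rw [← h2, show a.1 = (flip a).1 from rfl, ← h1]
      tauto
    exact Bool.eq_iff_iff.2 h3
  -- branches ending at a common switch continue into each other or into a common branch
  have hEconst := τ.eq_of_endPt_eq (E := E) fun a b hab => by
    rcases τ.tangent_line a b hab with h | h
    · obtain ⟨d, hd⟩ := τ.two_sided a
      refine (hsmooth a d hd).trans (hsmooth b d ⟨hab ▸ hd.1, ?_⟩).symm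
      exact h.symm.trans hd.2 fun h0 => (τ.endDir_ne_zero _ h0).elim
    · exact hsmooth a (flip b) ⟨by rw [hab, endPt_eq], by rwa [endDir_eq τ.branch b, neg_neg] at h⟩
  by_cases hne : Nonempty ι
  swap
  · exact ⟨true, fun x => (hne ⟨x.1⟩).elim⟩
  obtain ⟨i₀⟩ := hne
  refine ⟨E i₀, fun x l hl => ?_⟩
  have h : (0 < c.along (lr (lf (lift x 0))) (startDir τ.branch l) ↔ isPositive c lift x) ↔
      E x.1 = true := hE (x.1, true) x.2 l hl
  rw [hEconst i₀ x.1, ← h]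
  tauto

open Classical in
include hc hW hch in
/-- The transition matrix of the lifted track in terms of the words of the images. -/
theorem exists_transitionMatrix_lift_eq
    (hturn : ∀ a b, SmoothTurn τ.branch a b → ∀ x ∈ (orientedImage W a).getLast?,
      ∀ y ∈ (orientedImage W b).head?, SmoothTurn τ.branch x y) :
    ∃ ε : Bool, ∀ y x : ι × Bool, transitionMatrix lift (lr ∘ lf) y x =
      if isPositive c lift y ↔ isPositive c lift x then (W x.1).countP (· = (y.1, ε))
      else (W x.1).countP (· = (y.1, !ε)) := by
  obtain ⟨ε, hε⟩ := exists_global_preserves hlr hc hgN hlf hlift hW hch hturn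
  refine ⟨ε, fun y x => ?_⟩
  have h := hlift.occurrences_eq (f := fun t => lr (lf (lift x t)))
    (continuousOn_liftedMap_lift hlr hgN hlf hlift x)
    (fun t ht => proj_liftedMap_lift hlr hgN hlf hlift x ht) (hW x.1) (hch x.1) (hε x) y
  refine Eq.trans h ?_
  split_ifs with hxy <;> refine List.countP_congr fun l _ => ?_ <;>
    obtain ⟨k, b⟩ := l <;>
    by_cases hx : isPositive c lift x <;> simp only [hx, iff_true, iff_false, not_not] at hxy <;>
    cases ε <;> cases b <;> simp [hx, hxy]

end Equivariance

/-! ### Block matrices and spectra -/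

section Spectra

variable {κ : Type*} [Fintype κ] [DecidableEq κ]

theorem charpoly_fromBlocks_swap (A B : Matrix κ κ ℂ) :
    (Matrix.fromBlocks A B B A).charpoly = (A - B).charpoly * (A + B).charpoly := by
  -- conjugate into block triangular form
  have hQP : Matrix.fromBlocks 1 0 (-1) 1 * Matrix.fromBlocks 1 0 1 1 =
      (1 : Matrix (κ ⊕ κ) (κ ⊕ κ) ℂ) := by
    simp [Matrix.fromBlocks_multiply]
  have hconj : (Matrix.fromBlocks 1 0 1 1 * Matrix.fromBlocks A B B A *
      Matrix.fromBlocks 1 0 (-1) 1).charpoly = (Matrix.fromBlocks A B B A).charpoly := by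
    rw [Matrix.charpoly_mul_comm, ← mul_assoc, hQP, one_mul]
  rw [← hconj, ← Matrix.charpoly_fromBlocks_zero₂₁ (M₁₂ := B)]
  congr 1
  simp only [Matrix.fromBlocks_multiply]
  congr 1 <;> simp <;> abel

/-- The charpoly of a matrix indexed by two copies of `κ` which are exchanged by a symmetry; `q`
tells the copies apart. -/
theorem charpoly_of_involution [DecidableEq (κ × Bool)] {q : κ × Bool → Prop} [DecidablePred q]
    (hq : ∀ i, q (i, true) ↔ ¬ q (i, false)) (A B : Matrix κ κ ℂ)
    {M : Matrix (κ × Bool) (κ × Bool) ℂ}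
    (hM : ∀ y x, M y x = if q y ↔ q x then A y.1 x.1 else B y.1 x.1) :
    M.charpoly = (A - B).charpoly * (A + B).charpoly := by
  let φ : κ × Bool → κ ⊕ κ := fun x => if q x then Sum.inl x.1 else Sum.inr x.1
  have hφ : Function.Bijective φ := by
    constructor
    · rintro ⟨i, s⟩ ⟨j, t⟩ h
      have hi := hq i
      by_cases h1 : q (i, s) <;> by_cases h2 : q (j, t) <;> simp only [φ, h1, h2, if_true, if_false,
        Sum.inl.injEq, Sum.inr.injEq, reduceCtorEq] at h <;> subst h <;>
        cases s <;> cases t <;> simp_all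
    · rintro (i | i) <;> have hi := hq i <;> by_cases h : q (i, false)
      · exact ⟨(i, false), by simp [φ, h]⟩
      · exact ⟨(i, true), by simp [φ, h, hi]⟩
      · exact ⟨(i, true), by simp [φ, h, hi]⟩
      · exact ⟨(i, false), by simp [φ, h]⟩
  rw [← charpoly_fromBlocks_swap, ← Matrix.charpoly_reindex (Equiv.ofBijective φ hφ)]
  congr 1
  ext y x
  obtain ⟨y, rfl⟩ := hφ.2 y
  obtain ⟨x, rfl⟩ := hφ.2 x
  rw [Matrix.reindex_apply, Matrix.submatrix_apply]
  have hs : ∀ x, (Equiv.ofBijective φ hφ).symm (φ x) = x :=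
    (Equiv.ofBijective φ hφ).symm_apply_apply
  rw [hs, hs, hM]
  by_cases h1 : q y <;> by_cases h2 : q x <;> simp [φ, h1, h2]

theorem filter_eigenvalues_eq [DecidableEq (κ × Bool)] {q : κ × Bool → Prop} [DecidablePred q]
    (hq : ∀ i, q (i, true) ↔ ¬ q (i, false)) {S A B : Matrix κ κ ℕ}
    {S' : Matrix (κ × Bool) (κ × Bool) ℕ} (hS : S = A + B)
    (hS' : ∀ y x, S' y x = if q y ↔ q x then A y.1 x.1 else B y.1 x.1) (p : ℂ → Prop)
    [DecidablePred p]
    (hp : ∀ z ∈ (A.map (Nat.cast : ℕ → ℂ) - B.map (Nat.cast : ℕ → ℂ)).charpoly.roots, ¬ p z) :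
    (eigenvalues S).filter p = (eigenvalues S').filter p := by
  have h1 : S.map (Nat.cast : ℕ → ℂ) = A.map (Nat.cast : ℕ → ℂ) + B.map (Nat.cast : ℕ → ℂ) := by
    ext i j; simp [hS]
  have h2 := charpoly_of_involution hq (A.map (Nat.cast : ℕ → ℂ)) (B.map (Nat.cast : ℕ → ℂ))
    (M := S'.map (Nat.cast : ℕ → ℂ)) fun y x => by
      rw [Matrix.map_apply, hS']; split_ifs <;> rfl
  rw [eigenvalues, eigenvalues, h2, h1, Polynomial.roots_mul
    (mul_ne_zero (Matrix.charpoly_monic _).ne_zero (Matrix.charpoly_monic _).ne_zero),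
    Multiset.filter_add, Multiset.filter_eq_nil.2 hp, zero_add]

theorem det_sub_eq_zero_of_mem_roots {M : Matrix κ κ ℂ} {z : ℂ} (hz : z ∈ M.charpoly.roots) :
    (Matrix.scalar κ z - M).det = 0 := by
  rw [← Matrix.eval_charpoly]
  exact (Polynomial.mem_roots'.1 hz).2

theorem exists_mulVec_eq_smul_of_det {M : Matrix κ κ ℂ} {z : ℂ}
    (hz : (Matrix.scalar κ z - M).det = 0) : ∃ v, v ≠ 0 ∧ M.mulVec v = z • v := by
  obtain ⟨v, hv, h⟩ := Matrix.exists_mulVec_eq_zero_iff.2 hz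
  refine ⟨v, hv, ?_⟩
  rw [Matrix.sub_mulVec, sub_eq_zero] at h
  rw [← h]
  ext i
  simp [Matrix.mulVec_diagonal]

theorem exists_vecMul_eq_smul_of_det {M : Matrix κ κ ℂ} {z : ℂ}
    (hz : (Matrix.scalar κ z - M).det = 0) : ∃ v, v ≠ 0 ∧ M.vecMul v = z • v := by
  obtain ⟨v, hv, h⟩ := Matrix.exists_vecMul_eq_zero_iff.2 hz
  refine ⟨v, hv, ?_⟩
  rw [Matrix.vecMul_sub, sub_eq_zero] at h
  rw [← h]
  ext i
  simp [Matrix.vecMul_diagonal, mul_comm]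

theorem det_sub_eq_zero_of_vecMul {M : Matrix κ κ ℂ} {z : ℂ} {v : κ → ℂ} (hv : v ≠ 0)
    (h : M.vecMul v = z • v) : (Matrix.scalar κ z - M).det = 0 := by
  refine Matrix.exists_vecMul_eq_zero_iff.1 ⟨v, hv, ?_⟩
  rw [Matrix.vecMul_sub, sub_eq_zero, h]
  ext i
  simp [Matrix.vecMul_diagonal, mul_comm]

theorem letterSign_mul_self (s : Bool) : letterSign s * letterSign s = 1 := by
  cases s <;> simp [letterSign]

theorem isUnityRoot_of_letterSign_mul {s : Bool} {z : ℂ} (h : IsUnityRoot (letterSign s * z)) :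
    IsUnityRoot z := by
  obtain ⟨m, hm, h⟩ := h
  refine ⟨2 * m, by omega, ?_⟩
  have h1 : letterSign s ^ 2 = 1 := by rw [sq, letterSign_mul_self]
  have h2 : (letterSign s * z) ^ (2 * m) = 1 := by rw [mul_comm 2, pow_mul, h, one_pow]
  rwa [mul_pow, pow_mul, h1, one_pow, one_mul] at h2

/-- The eigenvalues of a diagonal block whose columns vanish off the block are eigenvalues of the
whole matrix: extend a left eigenvector by zero. -/
theorem det_sub_eq_zero_of_submatrix {p : κ → Prop} [DecidablePred p] {M : Matrix κ κ ℂ}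
    (hM : ∀ i j, p i → ¬ p j → M i j = 0) {z : ℂ}
    (hz : (Matrix.scalar {i // p i} z - M.submatrix Subtype.val Subtype.val).det = 0) :
    (Matrix.scalar κ z - M).det = 0 := by
  obtain ⟨u, hu, h⟩ := exists_vecMul_eq_smul_of_det hz
  refine det_sub_eq_zero_of_vecMul (v := fun i => if h : p i then u ⟨i, h⟩ else 0) ?_ ?_
  · obtain ⟨i, hi⟩ := Function.ne_iff.1 hu
    exact fun h0 => hi (by simpa [i.2] using congrFun h0 i)
  · have hsum : ∀ j, M.vecMul (fun i => if h : p i then u ⟨i, h⟩ else 0) j =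
        ∑ i : {i // p i}, u i * M i j := fun j => by
      rw [Matrix.vecMul, dotProduct, ← Finset.sum_filter_add_sum_filter_not _ p,
        Finset.sum_subtype _ (p := p) (by simp), Finset.sum_eq_zero (s := {i | ¬ p i}), add_zero]
      · exact Finset.sum_congr rfl fun i _ => by rw [dif_pos i.2]
      · intro i hi
        rw [dif_neg (Finset.mem_filter.1 hi).2, zero_mul]
    ext j
    rw [hsum]
    by_cases hj : p j
    · have := congrFun h ⟨j, hj⟩
      simpa [Matrix.vecMul, dotProduct, hj] using this
    · simp only [Pi.smul_apply, hj, dif_neg, not_false_eq_true, smul_zero]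
      exact Finset.sum_eq_zero fun i _ => by rw [hM i j i.2 hj, mul_zero]

end Spectra

end Track

open Classical in
theorem mainTheorem7 {n : ℕ} (D : Track.PuncturedDisk n) {ι : Type*} [Fintype ι]
    (τ : Track.TrainTrack D ι) (N : Track.FibredNhd τ)
    (f ψ : ℂ ≃ₜ ℂ) (hf : Track.IsDiskHomeo D f) (hψ : Track.IsotopicToId D ψ)
    (hinv : Track.CarriesImage τ N (ψ ∘ f))
    {M : Type*} [TopologicalSpace M] (c : Track.OrientationDoubleCover τ M)
    (hc : Disjoint c.branchPts N.carrier)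
    (lift : ι × Bool → ℝ → M) (hlift : Track.AreBranchLifts c lift)
    (lr : M → M) (hlr : Track.IsLiftedRetraction c N lr)
    (lf : M ≃ₜ M) (hlf : ∀ y, (c.proj (lf y) : ℂ) = ψ (f (c.proj y)))
    (T : Matrix ι ι ℕ) (hT : T = Track.transitionMatrix τ.branch (N.retr ∘ ψ ∘ f))
    (T' : Matrix (ι × Bool) (ι × Bool) ℕ) (hT' : T' = Track.transitionMatrix lift (lr ∘ lf)) :
    Track.IsospectralUpToUnityAndZero T T' ∧
    (Track.IsRegularFor τ N (ψ ∘ f) →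
      Track.IsospectralUpToUnity T T' ∧
      Track.IsospectralUpToUnity
        (T.submatrix (fun i : {i // ¬ Track.IsInfinitesimal τ i} => (i : ι))
          (fun i : {i // ¬ Track.IsInfinitesimal τ i} => (i : ι)))
        (T'.submatrix (fun x : {i // ¬ Track.IsInfinitesimal τ i} × Bool => ((x.1 : ι), x.2))
          (fun x : {i // ¬ Track.IsInfinitesimal τ i} × Bool => ((x.1 : ι), x.2)))) := by
  obtain ⟨hgN, W, hW, hch, hturn⟩ := hinv
  set g : ℂ ≃ₜ ℂ := f.trans ψ with hg
  have hgid : ∀ x, 1 ≤ ‖x‖ → g x = x := fun x hx => by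
    obtain ⟨H, -, hH1, hH⟩ := hψ
    obtain ⟨h, hh, hhH⟩ := hH 1
    have h1 : ψ x = x := by rw [← hH1, ← hhH, hh.1 x hx]
    change ψ (f x) = x
    rw [hf.1 x hx, h1]
  obtain ⟨ε, hε⟩ := Track.exists_transitionMatrix_lift_eq hlr hc (g := g) hgN hlf hlift hW hch hturn
  -- the signed count is the difference of the counts of the two kinds of letters
  set A : Matrix ι ι ℕ := Matrix.of fun i j => (W j).countP (· = (i, ε)) with hA
  set B : Matrix ι ι ℕ := Matrix.of fun i j => (W j).countP (· = (i, !ε)) with hB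
  have hTAB : T = A + B := by
    ext i j
    rw [hT]
    refine ((hW j).occurrences_eq (hch j) i).trans ?_
    rw [Matrix.add_apply, hA, hB, Matrix.of_apply, Matrix.of_apply]
    induction W j with
    | nil => rfl
    | cons x w ih =>
      rw [List.countP_cons, List.countP_cons, List.countP_cons, ih]
      obtain ⟨k, _ | _⟩ := x <;> cases ε <;> by_cases h : k = i <;> simp [h] <;> omega
  have hT'AB : ∀ y x, T' y x =
      if Track.isPositive c lift y ↔ Track.isPositive c lift x then A y.1 x.1 else B y.1 x.1 :=
    fun y x => by rw [hT', hε]; rfl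
  have hsigned : A.map (Nat.cast : ℕ → ℂ) - B.map (Nat.cast : ℕ → ℂ) =
      Track.letterSign ε • Track.signedMatrix W := by
    ext i j
    cases ε <;> simp [hA, hB, Track.signedMatrix, Track.letterSign]
  have hq := hlift.isPositive_true_iff
  have hvec : ∀ {z : ℂ},
      (Matrix.scalar ι z - Track.letterSign ε • Track.signedMatrix W).det = 0 →
      ∃ v, v ≠ 0 ∧ (Track.signedMatrix W).mulVec v = (Track.letterSign ε * z) • v := fun {z} hz => by
    obtain ⟨v, hv, h⟩ := Track.exists_mulVec_eq_smul_of_det hz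
    refine ⟨v, hv, ?_⟩
    rw [mul_smul, ← h, Matrix.smul_mulVec, smul_smul, Track.letterSign_mul_self, one_smul]
  refine ⟨Track.filter_eigenvalues_eq hq hTAB hT'AB _ fun z hz => ?_, fun hreg => ?_⟩
  · rw [hsigned] at hz
    obtain ⟨v, hv, h⟩ := hvec (Track.det_sub_eq_zero_of_mem_roots hz)
    rcases Track.eigenvalue_signedMatrix hgid hgN hW h hv with h0 | h1
    · have : z = 0 := by
        rw [← one_mul z, ← Track.letterSign_mul_self ε, mul_assoc, h0, mul_zero]
      exact fun h => h.1 this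
    · exact fun h => h.2 (Track.isUnityRoot_of_letterSign_mul h1)
  · have hunity : ∀ {z : ℂ},
        (Matrix.scalar ι z - Track.letterSign ε • Track.signedMatrix W).det = 0 →
        Track.IsUnityRoot z := fun {z} hz => by
      obtain ⟨v, hv, h⟩ := hvec hz
      exact Track.isUnityRoot_of_letterSign_mul
        (Track.IsRegularFor.isUnityRoot hgid hgN hW hreg h hv)
    refine ⟨Track.filter_eigenvalues_eq hq hTAB hT'AB _ fun z hz => ?_,
      Track.filter_eigenvalues_eq (κ := {i // ¬ Track.IsInfinitesimal τ i})
        (S := T.submatrix Subtype.val Subtype.val)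
        (S' := T'.submatrix (fun x => ((x.1 : ι), x.2)) (fun x => ((x.1 : ι), x.2)))
        (q := fun x => Track.isPositive c lift ((x.1 : ι), x.2))
        (A := A.submatrix Subtype.val Subtype.val) (B := B.submatrix Subtype.val Subtype.val)
        (fun i => hq i) (by rw [hTAB]; rfl) (fun y x => hT'AB _ _) _ fun z hz => ?_⟩
    · rw [hsigned] at hz
      exact not_not.2 (hunity (Track.det_sub_eq_zero_of_mem_roots hz))
    · rw [show (A.submatrix Subtype.val Subtype.val).map (Nat.cast : ℕ → ℂ) -
          (B.submatrix Subtype.val Subtype.val).map (Nat.cast : ℕ → ℂ) =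
          (A.map (Nat.cast : ℕ → ℂ) - B.map (Nat.cast : ℕ → ℂ)).submatrix
            (Subtype.val : {i // ¬ Track.IsInfinitesimal τ i} → ι) Subtype.val from rfl,
        hsigned] at hz
      refine not_not.2 (hunity (Track.det_sub_eq_zero_of_submatrix
        (p := fun i => ¬ Track.IsInfinitesimal τ i) (fun i j hi hj => ?_)
        (Track.det_sub_eq_zero_of_mem_roots hz)))
      obtain ⟨σ, hσ⟩ := hreg.1
      obtain ⟨s, hs⟩ := hσ ⟨j, not_not.1 hj⟩
      obtain ⟨s', hs'⟩ := (hW j).eq_singleton hs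
      have hne : ¬ (σ ⟨j, not_not.1 hj⟩ : ι) = i := fun h => hi (h ▸ (σ _).2)
      rw [Matrix.smul_apply, Track.signedMatrix_apply_eq_sum, hs']
      simp [hne]
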